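/- **Theorem 2.1.** Let $\mathcal X$ be a connected complete (smooth, finite-dimensional, second countable, without boundary) Riemannian manifold with Riemannian distance $d$ and Riemannian volume measure $dx$. Let $V\in C^1(\mathcal X)$ be such that $Z:=\int_{\mathcal X} e^{-V}\,dx<+\infty$, and let $\mu$ be the probability measure $\mu:=e^{-V}dx/Z$. Let $(\mathcal E,\mathbb D(\mathcal E))$ be the closure in $L^2(\mu)$ of the form $\mathcal E(g,g)=\int_{\mathcal X}|\nabla g|^2\,d\mu$, $g\in C_0^\infty(\mathcal X)$ (smooth functions with compact support). For a probability measure $\nu$ on the Borel sets of $\mathcal X$ put $$W_1(\nu,\mu):=\inf_{\pi}\iint d(x,y)\,\pi(dx,dy),$$ where $\pi$ runs over all couplings of $(\nu,\mu)$, that is, over the probability measures on $\mathcal X\times\mathcal X$ with first marginal $\nu$ and second marginal $\mu$; $$H(\nu|\mu):=\int \frac{d\nu}{d\mu}\log\frac{d\nu}{d\mu}\,d\mu\ \text{ if } \nu\ll\mu,\qquad H(\nu|\mu):=+\infty\ \text{ otherwise};$$ $$I(\nu|\mu):=\mathcal E(\sqrt f,\sqrt f)\ \text{ if } \nu=f\mu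 \text{ and } \sqrt f\in\mathbb D(\mathcal E),\qquad I(\nu|\mu):=+\infty\ \text{ otherwise}.$$ Let $C>0$. If $\mu$ satisfies $W_1I(C)$, i.e. $$W_1(\nu,\mu)^2\le 4C^2\, I(\nu|\mu)\quad\text{for all Borel probability measures } \nu \text{ on } \mathcal X,$$ then $\mu$ satisfies $W_1H(C)$, i.e. $$W_1(\nu,\mu)^2\le 2C\, H(\nu|\mu)\quad\text{for all Borel probability measures } \nu \text{ on } \mathcal X.$$ -/

import Mathlib

open MeasureTheory Filter Topology Bundle
open scoped Manifold ContDiff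

namespace TransportInformation

noncomputable section

section Wasserstein

/-- `γ` is a coupling of `ν` and `μ`: a measure on the product with marginals `ν` and `μ`. -/
def IsCoupling {X : Type*} [MeasurableSpace X] (γ : Measure (X × X)) (ν μ : Measure X) : Prop :=
  γ.map Prod.fst = ν ∧ γ.map Prod.snd = μ

/-- The `L¹`-Wasserstein distance `W₁(ν, μ) = inf_γ ∬ d(x, y) γ(dx, dy)`, the infimum being over
all couplings `γ` of `ν` and `μ`; it takes values in `[0, ∞]`. -/
def wassersteinOne {X : Type*} [MeasurableSpace X] [PseudoEMetricSpace X] (ν μ : Measure X) :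
    ENNReal :=
  ⨅ (γ : Measure (X × X)) (_ : IsCoupling γ ν μ), ∫⁻ p, edist p.1 p.2 ∂γ

end Wasserstein

section Manifold

/-- The Gram matrix `g_{ij}(u) = ⟨∂_i, ∂_j⟩` of the Riemannian metric in the preferred chart at
`c`, at the point of the manifold with coordinates `u`. Here `∂_i` is the image of the `i`-th
standard basis vector under the differential of the inverse chart. -/
def metricMatrix {n : ℕ} {M : Type*} [TopologicalSpace M]
    [ChartedSpace (EuclideanSpace ℝ (Fin n)) M]
    [RiemannianBundle (fun x : M ↦ TangentSpace 𝓘(ℝ, EuclideanSpace ℝ (Fin n)) x)]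
    (c : M) (u : EuclideanSpace ℝ (Fin n)) : Matrix (Fin n) (Fin n) ℝ :=
  Matrix.of fun i j ↦ inner ℝ
    (mfderiv 𝓘(ℝ, EuclideanSpace ℝ (Fin n)) 𝓘(ℝ, EuclideanSpace ℝ (Fin n))
      (chartAt (EuclideanSpace ℝ (Fin n)) c).symm u (EuclideanSpace.single i (1 : ℝ)))
    (mfderiv 𝓘(ℝ, EuclideanSpace ℝ (Fin n)) 𝓘(ℝ, EuclideanSpace ℝ (Fin n))
      (chartAt (EuclideanSpace ℝ (Fin n)) c).symm u (EuclideanSpace.single j (1 : ℝ)))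

/-- The Riemannian volume of the domain of the preferred chart at `c`, extended by zero to the
manifold: the image under the inverse chart of `√(det g_{ij}(u)) du` on the chart's target. -/
def chartVolume (n : ℕ) {M : Type*} [TopologicalSpace M] [MeasurableSpace M]
    [ChartedSpace (EuclideanSpace ℝ (Fin n)) M]
    [RiemannianBundle (fun x : M ↦ TangentSpace 𝓘(ℝ, EuclideanSpace ℝ (Fin n)) x)] (c : M) :
    Measure M :=
  (((volume : Measure (EuclideanSpace ℝ (Fin n))).restrict
      (chartAt (EuclideanSpace ℝ (Fin n)) c).target).withDensity
    fun u ↦ ENNReal.ofReal (Real.sqrt (metricMatrix c u).det)).map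
      (chartAt (EuclideanSpace ℝ (Fin n)) c).symm

/-- The Riemannian volume measure `dx`. The chart volumes agree on overlaps of chart domains, and
countably many chart domains cover the manifold, so that the supremum of the chart volumes (in the
lattice of measures) is the unique measure which restricts to the chart volume on each of the chart
domains. -/
def riemannianVolume (n : ℕ) (M : Type*) [TopologicalSpace M] [MeasurableSpace M]
    [ChartedSpace (EuclideanSpace ℝ (Fin n)) M]
    [RiemannianBundle (fun x : M ↦ TangentSpace 𝓘(ℝ, EuclideanSpace ℝ (Fin n)) x)] : Measure M :=
  ⨆ c : M, chartVolume n c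

/-- The normalization constant `Z = ∫ e^{-V} dx`. -/
def normalization (n : ℕ) {M : Type*} [TopologicalSpace M] [MeasurableSpace M]
    [ChartedSpace (EuclideanSpace ℝ (Fin n)) M]
    [RiemannianBundle (fun x : M ↦ TangentSpace 𝓘(ℝ, EuclideanSpace ℝ (Fin n)) x)]
    (V : M → ℝ) : ENNReal :=
  ∫⁻ x, ENNReal.ofReal (Real.exp (-V x)) ∂riemannianVolume n M

/-- The measure `μ = e^{-V} dx / Z`. -/
def gibbsMeasure (n : ℕ) {M : Type*} [TopologicalSpace M] [MeasurableSpace M]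
    [ChartedSpace (EuclideanSpace ℝ (Fin n)) M]
    [RiemannianBundle (fun x : M ↦ TangentSpace 𝓘(ℝ, EuclideanSpace ℝ (Fin n)) x)]
    (V : M → ℝ) : Measure M :=
  (normalization n V)⁻¹ •
    (riemannianVolume n M).withDensity fun x ↦ ENNReal.ofReal (Real.exp (-V x))

/-- The differential of a real function, as a linear form on the tangent space. -/
def differential (n : ℕ) {M : Type*} [TopologicalSpace M]
    [ChartedSpace (EuclideanSpace ℝ (Fin n)) M] (g : M → ℝ) (x : M) :
    TangentSpace 𝓘(ℝ, EuclideanSpace ℝ (Fin n)) x →L[ℝ] ℝ :=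
  mfderiv 𝓘(ℝ, EuclideanSpace ℝ (Fin n)) 𝓘(ℝ, ℝ) g x

/-- The length `|∇g|(x)` of the Riemannian gradient. By the Riesz isometry it is the operator norm
of the differential with respect to the Riemannian norm of the tangent space. -/
def gradNorm (n : ℕ) {M : Type*} [TopologicalSpace M]
    [ChartedSpace (EuclideanSpace ℝ (Fin n)) M]
    [RiemannianBundle (fun x : M ↦ TangentSpace 𝓘(ℝ, EuclideanSpace ℝ (Fin n)) x)]
    (g : M → ℝ) (x : M) : ℝ :=
  ‖differential n g x‖

/-- The energy `∫ |∇g|² dμ` (used for smooth `g`). -/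
def energy (n : ℕ) {M : Type*} [TopologicalSpace M] [MeasurableSpace M]
    [ChartedSpace (EuclideanSpace ℝ (Fin n)) M]
    [RiemannianBundle (fun x : M ↦ TangentSpace 𝓘(ℝ, EuclideanSpace ℝ (Fin n)) x)]
    (μ : Measure M) (g : M → ℝ) : ENNReal :=
  ∫⁻ x, ENNReal.ofReal (gradNorm n g x ^ 2) ∂μ

/-- The sequence `g` of smooth compactly supported functions converges to `f` in `L²(μ)` and is a
Cauchy sequence for the energy. -/
structure IsFormApprox (n : ℕ) {M : Type*} [TopologicalSpace M] [MeasurableSpace M]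
    [ChartedSpace (EuclideanSpace ℝ (Fin n)) M]
    [RiemannianBundle (fun x : M ↦ TangentSpace 𝓘(ℝ, EuclideanSpace ℝ (Fin n)) x)]
    (μ : Measure M) (f : M → ℝ) (g : ℕ → M → ℝ) : Prop where
  smooth : ∀ k, ContMDiff 𝓘(ℝ, EuclideanSpace ℝ (Fin n)) 𝓘(ℝ, ℝ) ∞ (g k)
  compact_support : ∀ k, HasCompactSupport (g k)
  tendsto_L2 : Tendsto (fun k ↦ eLpNorm (g k - f) 2 μ) atTop (𝓝 0)
  cauchy : Tendsto (fun p : ℕ × ℕ ↦ energy n μ (g p.1 - g p.2)) atTop (𝓝 0)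

/-- The domain `𝔻(ℰ)` of the closure of `g ↦ ∫ |∇g|² dμ`, `g ∈ C₀^∞(M)`, in `L²(μ)`. -/
def dirichletDomain (n : ℕ) {M : Type*} [TopologicalSpace M] [MeasurableSpace M]
    [ChartedSpace (EuclideanSpace ℝ (Fin n)) M]
    [RiemannianBundle (fun x : M ↦ TangentSpace 𝓘(ℝ, EuclideanSpace ℝ (Fin n)) x)]
    (μ : Measure M) : Set (M → ℝ) :=
  {f | MemLp f 2 μ ∧ ∃ g, IsFormApprox n μ f g}

/-- The closure `ℰ(f, f)` of `g ↦ ∫ |∇g|² dμ`, `g ∈ C₀^∞(M)`, for `f ∈ 𝔻(ℰ)`: it is the limit of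
`∫ |∇g_k|² dμ` along an approximating sequence. For `μ = e^{-V} dx / Z` with `V` of class `C¹` the
form is closable: the limit is the same for all approximating sequences, so that the infimum is over
a single value. -/
def dirichletForm (n : ℕ) {M : Type*} [TopologicalSpace M] [MeasurableSpace M]
    [ChartedSpace (EuclideanSpace ℝ (Fin n)) M]
    [RiemannianBundle (fun x : M ↦ TangentSpace 𝓘(ℝ, EuclideanSpace ℝ (Fin n)) x)]
    (μ : Measure M) (f : M → ℝ) : ENNReal :=
  ⨅ (g : ℕ → M → ℝ) (_ : IsFormApprox n μ f g), limsup (fun k ↦ energy n μ (g k)) atTop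

open scoped Classical in
/-- The Fisher information `I(ν|μ)`: it is `ℰ(√h, √h)` if `ν = h μ` with `√h ∈ 𝔻(ℰ)`, and `∞`
otherwise. -/
def fisherInformation (n : ℕ) {M : Type*} [TopologicalSpace M] [MeasurableSpace M]
    [ChartedSpace (EuclideanSpace ℝ (Fin n)) M]
    [RiemannianBundle (fun x : M ↦ TangentSpace 𝓘(ℝ, EuclideanSpace ℝ (Fin n)) x)]
    (ν μ : Measure M) : ENNReal :=
  if ν ≪ μ ∧ (fun x ↦ Real.sqrt (ν.rnDeriv μ x).toReal) ∈ dirichletDomain n μ then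
    dirichletForm n μ fun x ↦ Real.sqrt (ν.rnDeriv μ x).toReal
  else ⊤

end Manifold

section Inequalities

/-- The transportation-information inequality `W₁I(C)`: `W₁(ν, μ)² ≤ 4 C² I(ν|μ)` for all
probability measures `ν`. -/
def SatisfiesWOneI (n : ℕ) {M : Type*} [PseudoEMetricSpace M] [MeasurableSpace M]
    [ChartedSpace (EuclideanSpace ℝ (Fin n)) M]
    [RiemannianBundle (fun x : M ↦ TangentSpace 𝓘(ℝ, EuclideanSpace ℝ (Fin n)) x)]
    (μ : Measure M) (C : ℝ) : Prop :=
  ∀ ν : Measure M, IsProbabilityMeasure ν →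
    wassersteinOne ν μ ^ 2 ≤ ENNReal.ofReal (4 * C ^ 2) * fisherInformation n ν μ

/-- The transportation-entropy inequality `W₁H(C)`: `W₁(ν, μ)² ≤ 2 C H(ν|μ)` for all probability
measures `ν`. The relative entropy `H(ν|μ)` is the Kullback-Leibler divergence. -/
def SatisfiesWOneH {X : Type*} [PseudoEMetricSpace X] [MeasurableSpace X]
    (μ : Measure X) (C : ℝ) : Prop :=
  ∀ ν : Measure X, IsProbabilityMeasure ν →
    wassersteinOne ν μ ^ 2 ≤ ENNReal.ofReal (2 * C) * InformationTheory.klDiv ν μ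

end Inequalities

end

end TransportInformation

/-! Both inequalities are linked by Gaussian concentration of Lipschitz functions. Let F be bounded
and 1-Lipschitz, and let ν_t be the probability measure proportional to e^{tF} μ, for t ≥ 0.
Formally √(dν_t/dμ) is a multiple of e^{tF/2}, so |∇F| ≤ 1 gives I(ν_t|μ) ≤ t²/4, and W₁I(C) yields
W₁(ν_t, μ) ≤ C t. By the easy half of duality, ∫ F dν_t ≤ ∫ F dμ + C t. The left side is the
derivative of log ∫ e^{tF} dμ, so integration in t gives ∫ e^{tF} dμ ≤ exp(t ∫ F dμ + C t²/2): this
is `integral_exp_le_of_satisfiesWOneI`.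

From there the argument is that of Bobkov and Götze (`satisfiesWOneH_of_integral_exp_le`). The
Donsker–Varadhan inequality gives t (∫ F dν - ∫ F dμ) ≤ H(ν|μ) + C t²/2; the best t bounds the
difference of means by √(2 C H(ν|μ)), and the hard half of Kantorovich–Rubinstein duality
(`wassersteinOne_le_of_forall_lipschitzWith`) turns this bound, uniform in F, into a bound for W₁.

The form is generated by smooth compactly supported functions, so the formal computation needs two
inputs. A Lipschitz function must be smoothed at the cost of an arbitrarily small increase of the
gradient (`exists_contMDiff_hasCompactSupport_gradNorm_le`). And for compactly supported F the
function e^{tF/2} is 1, not 0, at infinity, so the constants must lie in the domain; this comes from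
cutoffs with small gradients (`exists_smooth_cutoff`). The cutoffs and the duality both rest on
compactness of closed balls, which is the Hopf–Rinow theorem. -/

namespace TransportInformation

noncomputable section

/-! ### Kantorovich–Rubinstein duality: a positive functional by extension -/

section KantorovichRubinstein

variable {X : Type*} [MetricSpace X]

/-- The functions on `X × X` of at most linear growth. -/
def linearGrowth (x₀ : X) : Submodule ℝ (X × X → ℝ) where
  carrier := {h | ∃ K, ∀ z, |h z| ≤ K * (1 + dist z.1 x₀ + dist z.2 x₀)}
  zero_mem' := ⟨0, fun z ↦ by simp⟩
  add_mem' := by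
    rintro a b ⟨K, hK⟩ ⟨K', hK'⟩
    refine ⟨K + K', fun z ↦ (abs_add_le _ _).trans ?_⟩
    linarith [hK z, hK' z]
  smul_mem' := by
    rintro c a ⟨K, hK⟩
    refine ⟨|c| * K, fun z ↦ ?_⟩
    rw [Pi.smul_apply, smul_eq_mul, abs_mul, mul_assoc]
    exact mul_le_mul_of_nonneg_left (hK z) (abs_nonneg c)

lemma dist_mem_linearGrowth (x₀ : X) : (fun z : X × X ↦ dist z.1 z.2) ∈ linearGrowth x₀ := by
  refine ⟨1, fun z ↦ ?_⟩
  rw [abs_of_nonneg dist_nonneg]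
  linarith [dist_triangle_right z.1 z.2 x₀]

lemma mem_linearGrowth_of_abs_le (x₀ : X) {h h' : X × X → ℝ} (hh : h' ∈ linearGrowth x₀)
    (hle : ∀ z, |h z| ≤ |h' z|) : h ∈ linearGrowth x₀ :=
  let ⟨K, hK⟩ := hh
  ⟨K, fun z ↦ (hle z).trans (hK z)⟩

lemma mem_linearGrowth_of_bounded (x₀ : X) {h : X × X → ℝ} {B : ℝ} (hB : ∀ z, |h z| ≤ B) :
    h ∈ linearGrowth x₀ := by
  refine ⟨B, fun z ↦ (hB z).trans ?_⟩
  have : 0 ≤ B := (abs_nonneg _).trans (hB z)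
  nlinarith [mul_nonneg this (dist_nonneg (x := z.1) (y := x₀)),
    mul_nonneg this (dist_nonneg (x := z.2) (y := x₀))]

variable [MeasurableSpace X] [BorelSpace X]

lemma integrable_of_lipschitzWith_one {ν : Measure X} [IsProbabilityMeasure ν]
    {x₀ : X} (hν : Integrable (fun x ↦ dist x x₀) ν)
    {f : X → ℝ} (hf : LipschitzWith 1 f) : Integrable f ν := by
  refine ((integrable_const |f x₀|).add hν).mono' hf.continuous.measurable.aestronglyMeasurable
    (ae_of_all _ fun x ↦ ?_)
  have := hf.dist_le_mul x x₀
  rw [Real.dist_eq] at this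
  simp only [NNReal.coe_one, one_mul] at this
  have h2 : |f x| ≤ |f x₀| + |f x - f x₀| := by
    have := abs_add_le (f x₀) (f x - f x₀)
    simpa using this
  simpa using h2.trans (by gcongr)

/-- A pair of functions dominating a multiple of `S - d` has nonnegative total integral, if `S`
bounds the differences of the integrals of the `1`-Lipschitz functions. -/
lemma integral_add_integral_nonneg_of_le {ν μ : Measure X} [IsProbabilityMeasure ν]
    [IsProbabilityMeasure μ] {x₀ : X} (hν : Integrable (fun x ↦ dist x x₀) ν)
    (hμ : Integrable (fun x ↦ dist x x₀) μ) {S : ℝ}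
    (hS : ∀ f : X → ℝ, LipschitzWith 1 f → ∫ x, f x ∂ν - ∫ x, f x ∂μ ≤ S)
    {φ ψ : X → ℝ} (hφ : Integrable φ ν) (hψ : Integrable ψ μ) {t : ℝ} (ht : 0 ≤ t)
    (h : ∀ x y, t * (S - dist x y) ≤ φ x + ψ y) :
    0 ≤ ∫ x, φ x ∂ν + ∫ x, ψ x ∂μ := by
  rcases ht.eq_or_lt with rfl | ht
  · have h1 : ∫ x, φ x ∂ν + ∫ y, ψ y ∂μ = ∫ z, (φ z.1 + ψ z.2) ∂(ν.prod μ) := by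
      rw [integral_add (hφ.comp_fst μ) (hψ.comp_snd ν), integral_fun_fst, integral_fun_snd]
      simp
    rw [h1]
    exact integral_nonneg fun z ↦ by simpa using h z.1 z.2
  · have : Nonempty X := ⟨x₀⟩
    -- The infimal convolution of the distance with ψ / t is 1-Lipschitz and lies between S - φ / t
    -- and ψ / t, so testing `hS` on it compares the two integrals.
    set f : X → ℝ := fun x ↦ ⨅ y, (dist x y + ψ y / t) with hf
    have lower : ∀ x y, S - φ x / t ≤ dist x y + ψ y / t := fun x y ↦ by
      have h1 := h x y
      have h2 : S - dist x y ≤ (φ x + ψ y) / t := by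
        rw [le_div_iff₀ ht]; linarith
      rw [add_div] at h2
      linarith
    have bdd : ∀ x, BddBelow (Set.range fun y ↦ dist x y + ψ y / t) := fun x ↦
      ⟨S - φ x / t, by rintro _ ⟨y, rfl⟩; exact lower x y⟩
    have f_lip : LipschitzWith 1 f := by
      refine LipschitzWith.of_le_add fun x x' ↦ ?_
      rw [← sub_le_iff_le_add]
      refine le_ciInf fun y ↦ ?_
      have := ciInf_le (bdd x) y
      have h3 := dist_triangle x x' y
      simp only [hf]
      linarith
    have h1 : S - (∫ x, φ x ∂ν) / t ≤ ∫ x, f x ∂ν := by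
      rw [← integral_div]
      have : S = ∫ _, S ∂ν := by simp
      rw [this, ← integral_sub (integrable_const _) (hφ.div_const t)]
      exact integral_mono ((integrable_const _).sub (hφ.div_const t))
        (integrable_of_lipschitzWith_one hν f_lip) fun x ↦ le_ciInf fun y ↦ by simpa using lower x y
    have h2 : ∫ x, f x ∂μ ≤ (∫ x, ψ x ∂μ) / t := by
      rw [← integral_div]
      refine integral_mono (integrable_of_lipschitzWith_one hμ f_lip) (hψ.div_const t) fun x ↦ ?_
      simpa using ciInf_le (bdd x) x
    have h3 := hS f f_lip
    have h4 : 0 ≤ (∫ x, φ x ∂ν + ∫ x, ψ x ∂μ) / t := by rw [add_div]; linarith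
    rcases div_nonneg_iff.1 h4 with h5 | h5
    · exact h5.1
    · exact absurd h5.2 (not_le.2 ht)

/-- The functions `(x, y) ↦ φ x + ψ y` with `φ` and `ψ` integrable. -/
def separatedSums (ν μ : Measure X) (x₀ : X) : Submodule ℝ (linearGrowth x₀) where
  carrier := {h | ∃ φ ψ : X → ℝ, Integrable φ ν ∧ Integrable ψ μ ∧
    ∀ z, (h : X × X → ℝ) z = φ z.1 + ψ z.2}
  zero_mem' := ⟨0, 0, integrable_zero _ _ _, integrable_zero _ _ _, fun z ↦ by simp⟩
  add_mem' := by
    rintro a b ⟨φ, ψ, h1, h2, h3⟩ ⟨φ', ψ', h1', h2', h3'⟩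
    refine ⟨φ + φ', ψ + ψ', h1.add h1', h2.add h2', fun z ↦ ?_⟩
    simp only [Submodule.coe_add, Pi.add_apply, h3, h3']
    ring
  smul_mem' := by
    rintro c a ⟨φ, ψ, h1, h2, h3⟩
    refine ⟨c • φ, c • ψ, h1.smul c, h2.smul c, fun z ↦ ?_⟩
    simp only [Submodule.coe_smul, Pi.smul_apply, h3, smul_eq_mul]
    ring

/-- The decomposition of a separated sum is not unique (constants can be moved), but its integral
against the product measure visibly does not depend on it. This makes the functional on
`separatedSums` well defined and linear. -/
lemma integral_prod_add {Y : Type*} [MeasurableSpace Y] {ν μ : Measure Y}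
    [IsProbabilityMeasure ν] [IsProbabilityMeasure μ] {h : Y × Y → ℝ} {φ ψ : Y → ℝ}
    (hφ : Integrable φ ν) (hψ : Integrable ψ μ)
    (hh : ∀ z, h z = φ z.1 + ψ z.2) :
    Integrable h (ν.prod μ) ∧ ∫ z, h z ∂(ν.prod μ) = ∫ x, φ x ∂ν + ∫ x, ψ x ∂μ := by
  have : h = fun z ↦ φ z.1 + ψ z.2 := funext hh
  subst this
  refine ⟨(hφ.comp_fst μ).add (hψ.comp_snd ν), ?_⟩
  rw [integral_add (hφ.comp_fst μ) (hψ.comp_snd ν), integral_fun_fst, integral_fun_snd]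
  simp

/-- A positive functional on the functions of linear growth, with marginals `ν` and `μ`, whose value
at the distance is at most `S`. -/
lemma exists_positive_functional {ν μ : Measure X} [IsProbabilityMeasure ν]
    [IsProbabilityMeasure μ] {x₀ : X} (hν : Integrable (fun x ↦ dist x x₀) ν)
    (hμ : Integrable (fun x ↦ dist x x₀) μ) {S : ℝ}
    (hS : ∀ f : X → ℝ, LipschitzWith 1 f → ∫ x, f x ∂ν - ∫ x, f x ∂μ ≤ S) :
    ∃ g : linearGrowth x₀ →ₗ[ℝ] ℝ,
      (∀ h : linearGrowth x₀, (∀ z, 0 ≤ (h : X × X → ℝ) z) → 0 ≤ g h) ∧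
      (∀ (h : linearGrowth x₀) (φ ψ : X → ℝ), Integrable φ ν → Integrable ψ μ →
        (∀ z, (h : X × X → ℝ) z = φ z.1 + ψ z.2) → g h = ∫ x, φ x ∂ν + ∫ x, ψ x ∂μ) ∧
      g ⟨fun z ↦ dist z.1 z.2, dist_mem_linearGrowth x₀⟩ ≤ S := by
  -- Nonnegativity on this cone encodes two requirements at once: t = 0 gives positivity of the
  -- functional, and t = 1 applied to S - d gives the bound S at the distance.
  let s : PointedCone ℝ (linearGrowth x₀) :=
    { carrier := {h | ∃ t : ℝ, 0 ≤ t ∧ ∀ z, t * (S - dist z.1 z.2) ≤ (h : X × X → ℝ) z}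
      zero_mem' := ⟨0, le_rfl, fun z ↦ by simp⟩
      add_mem' := by
        rintro a b ⟨t, ht, h⟩ ⟨t', ht', h'⟩
        refine ⟨t + t', add_nonneg ht ht', fun z ↦ ?_⟩
        have := h z
        have := h' z
        simp only [Submodule.coe_add, Pi.add_apply]
        linarith
      smul_mem' := by
        rintro c a ⟨t, ht, h⟩
        refine ⟨c * t, mul_nonneg c.2 ht, fun z ↦ ?_⟩
        have := mul_le_mul_of_nonneg_left (h z) c.2
        rw [mul_assoc]
        exact this }
  let f : linearGrowth x₀ →ₗ.[ℝ] ℝ :=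
    { domain := separatedSums ν μ x₀
      toFun :=
        { toFun := fun h ↦ ∫ z, ((h : linearGrowth x₀) : X × X → ℝ) z ∂(ν.prod μ)
          map_add' := by
            rintro ⟨a, φ, ψ, h1, h2, h3⟩ ⟨b, φ', ψ', h1', h2', h3'⟩
            exact integral_add (integral_prod_add h1 h2 h3).1 (integral_prod_add h1' h2' h3').1
          map_smul' := fun c a ↦ integral_const_mul c _ } }
  obtain ⟨g, hg, hgs⟩ := riesz_extension s f
    (by
      rintro ⟨h, φ, ψ, h1, h2, h3⟩ ⟨t, ht, hh⟩
      change 0 ≤ ∫ z, (h : X × X → ℝ) z ∂(ν.prod μ)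
      rw [(integral_prod_add h1 h2 h3).2]
      exact integral_add_integral_nonneg_of_le hν hμ hS h1 h2 ht
        fun x y ↦ (hh (x, y)).trans_eq (h3 (x, y)))
    (by
      rintro ⟨y, K, hK⟩
      -- The extension theorem asks that every element be moved into the cone by an element of the
      -- domain. The growth bound is itself a separated sum, integrable by the first moments; this
      -- is why the functions are restricted to linear growth.
      have hw : (fun z : X × X ↦ K * (1 + dist z.1 x₀) + K * dist z.2 x₀) ∈ linearGrowth x₀ :=
        ⟨|K|, fun z ↦ by
          beta_reduce
          rw [← mul_add, abs_mul, abs_of_nonneg (a := 1 + dist z.1 x₀ + dist z.2 x₀)]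
          positivity⟩
      refine ⟨⟨⟨_, hw⟩, fun x ↦ K * (1 + dist x x₀), fun x ↦ K * dist x x₀,
        ((integrable_const _).add hν).const_mul K, hμ.const_mul K, fun z ↦ rfl⟩, 0, le_rfl,
        fun z ↦ ?_⟩
      have := (abs_le.1 (hK z)).1
      simp only [zero_mul, Submodule.coe_add, Pi.add_apply]
      linarith)
  have hg' : ∀ (h : linearGrowth x₀) (φ ψ : X → ℝ), Integrable φ ν → Integrable ψ μ →
      (∀ z, (h : X × X → ℝ) z = φ z.1 + ψ z.2) → g h = ∫ x, φ x ∂ν + ∫ x, ψ x ∂μ :=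
    fun h φ ψ h1 h2 h3 ↦ (hg ⟨h, φ, ψ, h1, h2, h3⟩).trans (integral_prod_add h1 h2 h3).2
  refine ⟨g, fun h hh ↦ hgs h ⟨0, le_rfl, fun z ↦ by simpa using hh z⟩, hg', ?_⟩
  have hc : (fun _ : X × X ↦ S) ∈ linearGrowth x₀ := mem_linearGrowth_of_bounded x₀ fun _ ↦ le_rfl
  have h1 : 0 ≤ g (⟨_, hc⟩ - ⟨_, dist_mem_linearGrowth x₀⟩) :=
    hgs _ ⟨1, zero_le_one, fun z ↦ by rw [one_mul]; rfl⟩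
  have h2 : g ⟨_, hc⟩ = S := by
    rw [hg' ⟨_, hc⟩ (fun _ ↦ S) (fun _ ↦ 0) (integrable_const _) (integrable_const _)
      fun z ↦ by simp]
    simp
  rw [map_sub, h2] at h1
  linarith
end KantorovichRubinstein

/-! ### Radial cutoffs -/

section Cutoff

variable {X : Type*} [MetricSpace X]

/-- The cutoff which is `1` on the ball of radius `R` and `0` outside the ball of radius `R + 1`. -/
def radialCutoff (x₀ : X) (R : ℝ) (x : X) : ℝ := max 0 (min 1 (R + 1 - dist x x₀))

lemma radialCutoff_nonneg (x₀ : X) (R : ℝ) (x : X) : 0 ≤ radialCutoff x₀ R x := le_max_left _ _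

lemma radialCutoff_le_one (x₀ : X) (R : ℝ) (x : X) : radialCutoff x₀ R x ≤ 1 :=
  max_le zero_le_one (min_le_left _ _)

lemma radialCutoff_eq_one {x₀ : X} {R : ℝ} {x : X} (h : dist x x₀ ≤ R) :
    radialCutoff x₀ R x = 1 := by
  rw [radialCutoff, min_eq_left (by linarith), max_eq_right zero_le_one]

lemma radialCutoff_eq_zero {x₀ : X} {R : ℝ} {x : X} (h : R + 1 ≤ dist x x₀) :
    radialCutoff x₀ R x = 0 := by
  rw [radialCutoff, min_eq_right (by linarith), max_eq_left (by linarith)]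

lemma continuous_radialCutoff (x₀ : X) (R : ℝ) : Continuous (radialCutoff x₀ R) := by
  unfold radialCutoff
  fun_prop

lemma radialCutoff_mono (x₀ : X) {R R' : ℝ} (h : R ≤ R') (x : X) :
    radialCutoff x₀ R x ≤ radialCutoff x₀ R' x := by
  unfold radialCutoff
  gcongr

lemma tendsto_radialCutoff (x₀ : X) (x : X) :
    Tendsto (fun k : ℕ ↦ radialCutoff x₀ k x) atTop (𝓝 1) := by
  obtain ⟨N, hN⟩ := exists_nat_ge (dist x x₀)
  refine tendsto_const_nhds.congr' ?_
  filter_upwards [eventually_ge_atTop N] with k hk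
  exact (radialCutoff_eq_one (hN.trans (by exact_mod_cast hk))).symm

lemma hasCompactSupport_mul_radialCutoff [ProperSpace X] (x₀ : X) (R : ℝ) (h : X × X → ℝ) :
    HasCompactSupport fun z : X × X ↦ h z * (radialCutoff x₀ R z.1 * radialCutoff x₀ R z.2) := by
  refine HasCompactSupport.intro ((isCompact_closedBall x₀ (R + 1)).prod
    (isCompact_closedBall x₀ (R + 1))) fun z hz ↦ ?_
  simp only [Set.mem_prod, Metric.mem_closedBall, not_and_or, not_le] at hz
  rcases hz with hz | hz <;> simp [radialCutoff_eq_zero hz.le]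

end Cutoff

/-! ### Kantorovich–Rubinstein duality: from the functional to a coupling -/

section KantorovichRubinstein

open scoped CompactlySupported

variable {X : Type*} [MetricSpace X] [MeasurableSpace X] [BorelSpace X] [ProperSpace X]

/-- The **Kantorovich-Rubinstein duality** (the nontrivial inequality) for measures with finite
first moments. -/
theorem wassersteinOne_le_of_forall_lipschitzWith {ν μ : Measure X} [IsProbabilityMeasure ν]
    [IsProbabilityMeasure μ] {x₀ : X} (hν : Integrable (fun x ↦ dist x x₀) ν)
    (hμ : Integrable (fun x ↦ dist x x₀) μ) {S : ℝ}
    (hS : ∀ f : X → ℝ, LipschitzWith 1 f → ∫ x, f x ∂ν - ∫ x, f x ∂μ ≤ S) :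
    wassersteinOne ν μ ≤ ENNReal.ofReal S := by
  obtain ⟨g, g_pos, g_sep, g_dist⟩ := exists_positive_functional hν hμ hS
  have g_mono : ∀ h h' : linearGrowth x₀, (∀ z, (h : X × X → ℝ) z ≤ (h' : X × X → ℝ) z) →
      g h ≤ g h' := fun h h' hle ↦ by
    have := g_pos (h' - h) fun z ↦ sub_nonneg.2 (hle z)
    rw [map_sub] at this
    linarith
  have mem_cc : ∀ h : C_c(X × X, ℝ), (h : X × X → ℝ) ∈ linearGrowth x₀ := fun h ↦ by
    obtain ⟨B, hB⟩ := h.hasCompactSupport.exists_bound_of_continuous h.continuous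
    exact mem_linearGrowth_of_bounded x₀ hB
  -- The Riesz–Markov measure sees `g` only on compactly supported functions. For other nonnegative
  -- functions, cutting off yields only an upper bound by `g`; that no mass is lost at infinity has
  -- to be deduced from the marginals.
  let Λ : C_c(X × X, ℝ) →ₚ[ℝ] ℝ := PositiveLinearMap.mk₀
    { toFun := fun h ↦ g ⟨h, mem_cc h⟩
      map_add' := fun a b ↦ g.map_add ⟨a, mem_cc a⟩ ⟨b, mem_cc b⟩
      map_smul' := fun c a ↦ g.map_smul c ⟨a, mem_cc a⟩ } fun h hh ↦ g_pos _ hh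
  set γ : Measure (X × X) := RealRMK.rieszMeasure Λ with hγ
  have γ_int : ∀ h : C_c(X × X, ℝ), ∫ z, h z ∂γ = g ⟨h, mem_cc h⟩ := fun h ↦
    RealRMK.integral_rieszMeasure Λ h
  let χ : ℕ → X × X → ℝ := fun k z ↦ radialCutoff x₀ k z.1 * radialCutoff x₀ k z.2
  have χ_nonneg : ∀ k z, 0 ≤ χ k z := fun k z ↦
    mul_nonneg (radialCutoff_nonneg _ _ _) (radialCutoff_nonneg _ _ _)
  have χ_le_one : ∀ k z, χ k z ≤ 1 := fun k z ↦
    mul_le_one₀ (radialCutoff_le_one _ _ _) (radialCutoff_nonneg _ _ _) (radialCutoff_le_one _ _ _)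
  have χ_cont : ∀ k, Continuous (χ k) := fun k ↦
    ((continuous_radialCutoff x₀ k).comp continuous_fst).mul
      ((continuous_radialCutoff x₀ k).comp continuous_snd)
  have χ_mono : ∀ z, Monotone fun k ↦ χ k z := fun z k l hkl ↦
    mul_le_mul (radialCutoff_mono _ (by exact_mod_cast hkl) _)
      (radialCutoff_mono _ (by exact_mod_cast hkl) _) (radialCutoff_nonneg _ _ _)
      (radialCutoff_nonneg _ _ _)
  have χ_tendsto : ∀ z, Tendsto (fun k ↦ χ k z) atTop (𝓝 1) := fun z ↦ by
    simpa using (tendsto_radialCutoff x₀ z.1).mul (tendsto_radialCutoff x₀ z.2)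
  -- the lower integral of a nonnegative continuous function is at most the value of `g`
  have mem_mul : ∀ (h : linearGrowth x₀) (k : ℕ),
      (fun z ↦ (h : X × X → ℝ) z * χ k z) ∈ linearGrowth x₀ := fun h k ↦
    mem_linearGrowth_of_abs_le x₀ h.2 fun z ↦ by
      rw [abs_mul, abs_of_nonneg (χ_nonneg k z)]
      exact mul_le_of_le_one_right (abs_nonneg _) (χ_le_one k z)
  have lint_cut : ∀ (h : linearGrowth x₀), Continuous (h : X × X → ℝ) →
      (∀ z, 0 ≤ (h : X × X → ℝ) z) → ∀ k,
      ∫⁻ z, ENNReal.ofReal ((h : X × X → ℝ) z * χ k z) ∂γ =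
        ENNReal.ofReal (g ⟨_, mem_mul h k⟩) := by
    intro h h_cont h_nonneg k
    let H : C_c(X × X, ℝ) := ⟨⟨fun z ↦ (h : X × X → ℝ) z * χ k z, h_cont.mul (χ_cont k)⟩,
      hasCompactSupport_mul_radialCutoff x₀ k _⟩
    have h1 := γ_int H
    have h2 : Integrable (fun z ↦ (h : X × X → ℝ) z * χ k z) γ :=
      H.continuous.integrable_of_hasCompactSupport H.hasCompactSupport
    rw [← ofReal_integral_eq_lintegral_ofReal h2
      (ae_of_all _ fun z ↦ mul_nonneg (h_nonneg z) (χ_nonneg k z))]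
    exact congrArg ENNReal.ofReal h1
  have lint_le : ∀ (h : linearGrowth x₀), Continuous (h : X × X → ℝ) →
      (∀ z, 0 ≤ (h : X × X → ℝ) z) →
      ∫⁻ z, ENNReal.ofReal ((h : X × X → ℝ) z) ∂γ ≤ ENNReal.ofReal (g h) := by
    intro h h_cont h_nonneg
    have hlim : Tendsto (fun k ↦ ∫⁻ z, ENNReal.ofReal ((h : X × X → ℝ) z * χ k z) ∂γ) atTop
        (𝓝 (∫⁻ z, ENNReal.ofReal ((h : X × X → ℝ) z) ∂γ)) := by
      refine lintegral_tendsto_of_tendsto_of_monotone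
        (fun k ↦ (h_cont.mul (χ_cont k)).measurable.ennreal_ofReal.aemeasurable)
        (ae_of_all _ fun z k l hkl ↦ ENNReal.ofReal_le_ofReal
          (mul_le_mul_of_nonneg_left (χ_mono z hkl) (h_nonneg z)))
        (ae_of_all _ fun z ↦ ENNReal.tendsto_ofReal ?_)
      simpa using (χ_tendsto z).const_mul ((h : X × X → ℝ) z)
    refine le_of_tendsto' hlim fun k ↦ ?_
    rw [lint_cut h h_cont h_nonneg k]
    exact ENNReal.ofReal_le_ofReal (g_mono _ _ fun z ↦
      mul_le_of_le_one_right (h_nonneg z) (χ_le_one k z))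
  -- the total mass
  have hone : (fun _ : X × X ↦ (1 : ℝ)) ∈ linearGrowth x₀ :=
    mem_linearGrowth_of_bounded x₀ fun _ ↦ le_rfl
  have g_one : g ⟨_, hone⟩ = 1 := by
    rw [g_sep ⟨_, hone⟩ (fun _ ↦ 1) (fun _ ↦ 0) (integrable_const _) (integrable_const _)
      fun z ↦ by simp]
    simp
  have cut_int : ∀ (ρ : Measure X) [IsProbabilityMeasure ρ] (k : ℕ),
      Integrable (radialCutoff x₀ k) ρ := fun ρ _ k ↦
    (integrable_const (1 : ℝ)).mono' (continuous_radialCutoff x₀ k).aestronglyMeasurable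
      (ae_of_all _ fun x ↦ by
        rw [Real.norm_of_nonneg (radialCutoff_nonneg _ _ _)]
        exact radialCutoff_le_one _ _ _)
  have cut_lim : ∀ (ρ : Measure X) [IsProbabilityMeasure ρ],
      Tendsto (fun k : ℕ ↦ ∫ x, radialCutoff x₀ k x ∂ρ) atTop (𝓝 1) := fun ρ _ ↦ by
    have := tendsto_integral_of_dominated_convergence (μ := ρ)
      (F := fun k : ℕ ↦ radialCutoff x₀ k) (f := fun _ ↦ (1 : ℝ)) (fun _ ↦ (1 : ℝ))
      (fun k ↦ (continuous_radialCutoff x₀ k).aestronglyMeasurable) (integrable_const _)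
      (fun k ↦ ae_of_all _ fun x ↦ by
        rw [Real.norm_of_nonneg (radialCutoff_nonneg _ _ _)]
        exact radialCutoff_le_one _ _ _)
      (ae_of_all _ fun x ↦ tendsto_radialCutoff x₀ x)
    simpa using this
  have mass : γ Set.univ = 1 := by
    have hle := lint_le ⟨_, hone⟩ continuous_const fun _ ↦ zero_le_one
    refine le_antisymm (by simpa [g_one] using hle) ?_
    -- With a and b the cutoffs of the two coordinates, (1 - a)(1 - b) ≥ 0 gives a + b - 1 ≤ a b.
    -- The left side is separated, so its value under `g` is known and tends to 1, while the right
    -- side is compactly supported.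
    have hlim : Tendsto (fun k : ℕ ↦ ENNReal.ofReal
        (∫ x, radialCutoff x₀ k x ∂ν + (∫ x, radialCutoff x₀ k x ∂μ - 1))) atTop (𝓝 1) := by
      have := (cut_lim ν).add ((cut_lim μ).sub_const 1)
      simpa using ENNReal.tendsto_ofReal this
    refine le_of_tendsto' hlim fun k ↦ ?_
    have hsep : (fun z : X × X ↦ radialCutoff x₀ k z.1 + (radialCutoff x₀ k z.2 - 1)) ∈
        linearGrowth x₀ := mem_linearGrowth_of_bounded x₀ (B := 1) fun z ↦ by
      rw [abs_le]
      constructor <;> linarith [radialCutoff_nonneg x₀ k z.1, radialCutoff_nonneg x₀ k z.2,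
        radialCutoff_le_one x₀ k z.1, radialCutoff_le_one x₀ k z.2]
    have h1 := g_sep ⟨_, hsep⟩ (radialCutoff x₀ k) (fun y ↦ radialCutoff x₀ k y - 1)
      (cut_int ν k) ((cut_int μ k).sub (integrable_const 1)) fun z ↦ rfl
    rw [integral_sub (cut_int μ k) (integrable_const 1)] at h1
    simp only [integral_const, probReal_univ, smul_eq_mul, mul_one] at h1
    have h2 : g ⟨_, hsep⟩ ≤ g ⟨_, mem_mul ⟨_, hone⟩ k⟩ := g_mono _ _ fun z ↦ by
      have := mul_nonneg (sub_nonneg.2 (radialCutoff_le_one x₀ k z.1))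
        (sub_nonneg.2 (radialCutoff_le_one x₀ k z.2))
      simp only [χ]
      linarith
    rw [← h1]
    refine (ENNReal.ofReal_le_ofReal h2).trans ?_
    rw [← lint_cut ⟨_, hone⟩ continuous_const (fun _ ↦ zero_le_one) k]
    refine (lintegral_mono (g := fun _ ↦ 1) fun z ↦ ?_).trans (by simp)
    simpa using ENNReal.ofReal_le_one.2 (χ_le_one k z)
  have : IsProbabilityMeasure γ := ⟨mass⟩
  -- the marginals
  have marginal : ∀ (ρ : Measure X) [IsProbabilityMeasure ρ] (p : X × X → X), Continuous p →
      (∀ (φ : X → ℝ) (hφ : Continuous φ) (B : ℝ) (hB : ∀ x, |φ x| ≤ B),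
        g ⟨fun z ↦ φ (p z), mem_linearGrowth_of_bounded x₀ fun z ↦ hB (p z)⟩ = ∫ x, φ x ∂ρ) →
      γ.map p = ρ := by
    intro ρ _ p hp hgρ
    have : IsProbabilityMeasure (γ.map p) := Measure.isProbabilityMeasure_map hp.aemeasurable
    -- One inequality suffices: both measures have mass 1, so applying it to f + B and to B - f
    -- gives equality for f.
    have key : ∀ φ : X → ℝ, Continuous φ → (∀ x, 0 ≤ φ x) → ∀ B, (∀ x, |φ x| ≤ B) →
        ∫ x, φ x ∂(γ.map p) ≤ ∫ x, φ x ∂ρ := by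
      intro φ hφ φ_nonneg B hB
      have h1 := lint_le ⟨fun z ↦ φ (p z), mem_linearGrowth_of_bounded x₀ fun z ↦ hB (p z)⟩
        (hφ.comp hp) fun z ↦ φ_nonneg _
      rw [hgρ φ hφ B hB] at h1
      rw [integral_eq_lintegral_of_nonneg_ae (ae_of_all _ φ_nonneg) hφ.aestronglyMeasurable,
        lintegral_map hφ.measurable.ennreal_ofReal hp.measurable]
      exact ENNReal.toReal_le_of_le_ofReal (integral_nonneg φ_nonneg) h1
    refine ext_of_forall_integral_eq_of_IsFiniteMeasure fun f ↦ ?_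
    set B := ‖f‖ with hB
    have f_le : ∀ x, |f x| ≤ B := f.norm_coe_le_norm
    have int_f : ∀ (η : Measure X) [IsProbabilityMeasure η], Integrable f η := fun η _ ↦
      f.integrable η
    have hbd : ∀ x, 0 ≤ f x + B ∧ f x + B ≤ 2 * B ∧ 0 ≤ B - f x ∧ B - f x ≤ 2 * B := fun x ↦ by
      have := abs_le.1 (f_le x)
      refine ⟨?_, ?_, ?_, ?_⟩ <;> linarith
    have h1 := key (fun x ↦ f x + B) (f.continuous.add continuous_const) (fun x ↦ (hbd x).1) (2 * B)
      fun x ↦ by rw [abs_of_nonneg (hbd x).1]; exact (hbd x).2.1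
    have h2 := key (fun x ↦ B - f x) (continuous_const.sub f.continuous) (fun x ↦ (hbd x).2.2.1)
      (2 * B) fun x ↦ by rw [abs_of_nonneg (hbd x).2.2.1]; exact (hbd x).2.2.2
    rw [integral_add (int_f _) (integrable_const _), integral_add (int_f _) (integrable_const _)]
      at h1
    rw [integral_sub (integrable_const _) (int_f _), integral_sub (integrable_const _) (int_f _)]
      at h2
    simp only [integral_const, probReal_univ, smul_eq_mul, one_mul] at h1 h2
    linarith
  have bdd_int : ∀ (ρ : Measure X) [IsProbabilityMeasure ρ] (φ : X → ℝ), Continuous φ → ∀ B,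
      (∀ x, |φ x| ≤ B) → Integrable φ ρ := fun ρ _ φ hφ B hB ↦
    (integrable_const B).mono' hφ.aestronglyMeasurable (ae_of_all _ hB)
  have hcoupling : IsCoupling γ ν μ := by
    refine ⟨marginal ν _ continuous_fst fun φ hφ B hB ↦ ?_,
      marginal μ _ continuous_snd fun φ hφ B hB ↦ ?_⟩
    · rw [g_sep _ φ (fun _ ↦ 0) (bdd_int ν φ hφ B hB) (integrable_const _) fun z ↦ by simp]
      simp
    · rw [g_sep _ (fun _ ↦ 0) φ (integrable_const _) (bdd_int μ φ hφ B hB) fun z ↦ by simp]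
      simp
  refine (iInf₂_le γ hcoupling).trans ?_
  simp_rw [edist_dist]
  exact (lint_le ⟨_, dist_mem_linearGrowth x₀⟩ continuous_dist fun z ↦ dist_nonneg).trans
    (ENNReal.ofReal_le_ofReal g_dist)

end KantorovichRubinstein

/-! ### Hopf–Rinow: closed balls are compact -/

section HopfRinow

/-- The **Hopf-Rinow theorem** for metric spaces: a complete locally compact space in which points
can be joined by almost shortest chains is proper. -/
theorem properSpace_of_forall_exists_dist_le {X : Type*} [MetricSpace X] [CompleteSpace X]
    [LocallyCompactSpace X]
    (h : ∀ (x y : X) (a b : ℝ), 0 ≤ a → 0 < b → dist x y < a + b →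
      ∃ z, dist x z ≤ a ∧ dist z y < b) :
    ProperSpace X := by
  refine ⟨fun x ↦ ?_⟩
  by_contra! hx
  obtain ⟨R, hR⟩ := hx
  -- Consider the supremum s of the radii of compact balls. Completeness makes the ball of radius s
  -- compact, and local compactness then gives a larger compact ball, a contradiction.
  set A : Set ℝ := {r | IsCompact (Metric.closedBall x r)} with hA
  have A_down : ∀ r ∈ A, ∀ r' ≤ r, r' ∈ A := fun r hr r' hr' ↦
    IsCompact.of_isClosed_subset hr Metric.isClosed_closedBall
      (Metric.closedBall_subset_closedBall hr')
  have zero_mem : (0 : ℝ) ∈ A := by simp [hA]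
  have A_bdd : BddAbove A := ⟨R, fun r hr ↦ by
    by_contra! hlt
    exact hR (A_down r hr R hlt.le)⟩
  set s := sSup A with hs
  have s_nonneg : 0 ≤ s := le_csSup A_bdd zero_mem
  have s_mem : s ∈ A := by
    refine TotallyBounded.isCompact_of_isClosed (Metric.totallyBounded_iff.2 fun ε hε ↦ ?_)
      Metric.isClosed_closedBall
    -- Since s < (s - ε/3) + ε/2, each point of the ball of radius s is within ε/2 of this smaller
    -- compact ball, and an ε/2-net of the latter is an ε-net of the former. The maximum with 0
    -- keeps the radius admissible in `h`.
    have hr : max (s - ε / 3) 0 ∈ A := by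
      rcases le_or_gt (s - ε / 3) 0 with h0 | h0
      · rwa [max_eq_right h0]
      · rw [max_eq_left h0.le]
        obtain ⟨r', hr', hlt⟩ := exists_lt_of_lt_csSup ⟨0, zero_mem⟩
          (show s - ε / 3 < s by linarith)
        exact A_down r' hr' _ hlt.le
    obtain ⟨t, ht, hcov⟩ := Metric.totallyBounded_iff.1 (IsCompact.totallyBounded hr) (ε / 2)
      (by positivity)
    refine ⟨t, ht, fun y hy ↦ ?_⟩
    rw [Metric.mem_closedBall'] at hy
    obtain ⟨z, hz, hzy⟩ := h x y (max (s - ε / 3) 0) (ε / 2) (le_max_right _ _) (by positivity)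
      (by linarith [le_max_left (s - ε / 3) 0])
    obtain ⟨w, hw, hzw⟩ := Set.mem_iUnion₂.1 (hcov (Metric.mem_closedBall'.2 hz))
    refine Set.mem_iUnion₂.2 ⟨w, hw, ?_⟩
    rw [Metric.mem_ball] at hzw ⊢
    linarith [dist_triangle_left y w z]
  obtain ⟨δ, hδ, hcomp⟩ := IsCompact.exists_isCompact_cthickening s_mem
  have hmem : s + δ / 2 ∈ A := by
    refine IsCompact.of_isClosed_subset hcomp Metric.isClosed_closedBall fun y hy ↦ ?_
    rw [Metric.mem_closedBall'] at hy
    obtain ⟨z, hz, hzy⟩ := h x y s δ s_nonneg hδ (by linarith)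
    exact Metric.mem_cthickening_of_dist_le y z δ _ (Metric.mem_closedBall'.2 hz)
      (by rw [dist_comm]; exact hzy.le)
  linarith [le_csSup A_bdd hmem]

/-- Take a path from x to y of length less than a + b and cut it where the distance from x equals a.
The part before the cut has length at least a, which leaves less than b for the rest. -/
lemma exists_dist_le_of_dist_lt_add {E : Type*} [NormedAddCommGroup E] [NormedSpace ℝ E]
    {H : Type*} [TopologicalSpace H] (I : ModelWithCorners ℝ E H) {M : Type*} [MetricSpace M]
    [ChartedSpace H M] [RiemannianBundle (fun x : M ↦ TangentSpace I x)] [IsRiemannianManifold I M]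
    (x y : M) (a b : ℝ) (ha : 0 ≤ a) (hb : 0 < b)
    (h : dist x y < a + b) : ∃ z, dist x z ≤ a ∧ dist z y < b := by
  rcases le_or_gt (dist x y) a with hxy | hxy
  · exact ⟨y, hxy, by simpa using hb⟩
  have hlt : Manifold.riemannianEDist I x y < ENNReal.ofReal (a + b) := by
    rw [← IsRiemannianManifold.out (I := I), edist_dist]
    exact (ENNReal.ofReal_lt_ofReal_iff (by linarith)).2 h
  obtain ⟨γ, γ0, γ1, γ_smooth, hγ⟩ := Manifold.exists_lt_of_riemannianEDist_lt hlt
  have hcont : ContinuousOn (fun t ↦ dist x (γ t)) (Set.Icc 0 1) :=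
    (continuous_const.dist continuous_id).comp_continuousOn γ_smooth.continuousOn
  obtain ⟨t, ht, hta⟩ : a ∈ (fun t ↦ dist x (γ t)) '' Set.Icc 0 1 :=
    intermediate_value_Icc zero_le_one hcont ⟨by simpa [γ0] using ha, by simpa [γ1] using hxy.le⟩
  refine ⟨γ t, hta.le, ?_⟩
  have h1 : edist x (γ t) ≤ Manifold.pathELength I γ 0 t := by
    rw [IsRiemannianManifold.out (I := I)]
    exact Manifold.riemannianEDist_le_pathELength
      (γ_smooth.mono (Set.Icc_subset_Icc_right ht.2)) γ0 rfl ht.1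
  have h2 : edist (γ t) y ≤ Manifold.pathELength I γ t 1 := by
    rw [IsRiemannianManifold.out (I := I)]
    exact Manifold.riemannianEDist_le_pathELength
      (γ_smooth.mono (Set.Icc_subset_Icc_left ht.1)) rfl γ1 ht.2
  have h3 : edist x (γ t) + edist (γ t) y < ENNReal.ofReal (a + b) := by
    refine (add_le_add h1 h2).trans_lt ?_
    rwa [Manifold.pathELength_add ht.1 ht.2]
  rw [edist_dist, edist_dist, ← ENNReal.ofReal_add dist_nonneg dist_nonneg,
    ENNReal.ofReal_lt_ofReal_iff (by linarith)] at h3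
  linarith [show dist x (γ t) = a from hta]

/-- The **Hopf-Rinow theorem**: a complete Riemannian manifold is a proper metric space. -/
theorem properSpace_of_isRiemannianManifold {E : Type*} [NormedAddCommGroup E] [NormedSpace ℝ E]
    {H : Type*} [TopologicalSpace H] (I : ModelWithCorners ℝ E H) (M : Type*) [MetricSpace M]
    [ChartedSpace H M] [RiemannianBundle (fun x : M ↦ TangentSpace I x)] [IsRiemannianManifold I M]
    [CompleteSpace M] [LocallyCompactSpace M] : ProperSpace M :=
  properSpace_of_forall_exists_dist_le (exists_dist_le_of_dist_lt_add I)

end HopfRinow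

/-! ### Mollification in a normed space -/

section Mollification

open scoped Convolution

/-- A real Lipschitz function on a finite-dimensional normed space is a uniform limit of smooth
functions with the same Lipschitz constant. -/
lemma exists_contDiff_lipschitzWith_dist_le {T : Type*} [NormedAddCommGroup T] [NormedSpace ℝ T]
    [FiniteDimensional ℝ T] {f : T → ℝ} {K : NNReal} (hf : LipschitzWith K f) {ε : ℝ}
    (hε : 0 < ε) :
    ∃ g : T → ℝ, ContDiff ℝ ∞ g ∧ LipschitzWith K g ∧ ∀ a, dist (g a) (f a) ≤ ε := by
  borelize T
  let μ : Measure T := Measure.addHaar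
  obtain ⟨δ, hδ, hKδ⟩ : ∃ δ : ℝ, 0 < δ ∧ K * δ ≤ ε :=
    ⟨ε / (K + 1), by positivity, by
      rw [mul_div_assoc', div_le_iff₀ (by positivity)]
      nlinarith [K.2]⟩
  set φ : ContDiffBump (0 : T) := ⟨δ / 2, δ, half_pos hδ, half_lt_self hδ⟩
  set g := (φ.normed μ ⋆[ContinuousLinearMap.lsmul ℝ ℝ, μ] f) with hg
  have hex : ∀ x, Integrable (fun t ↦ φ.normed μ t * f (x - t)) μ := fun x ↦ by
    refine (φ.continuous_normed.mul (hf.continuous.comp (continuous_const.sub continuous_id)))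
      |>.integrable_of_hasCompactSupport ?_
    exact φ.hasCompactSupport_normed.mul_right
  have hgx : ∀ x, g x = ∫ t, φ.normed μ t * f (x - t) ∂μ := fun x ↦ by
    simp [hg, convolution_def]
  refine ⟨g, φ.hasCompactSupport_normed.contDiff_convolution_left _ φ.contDiff_normed
    hf.continuous.locallyIntegrable, ?_, fun a ↦ ?_⟩
  -- Convolution with a nonnegative bump of integral 1 is an average of translates, so the Lipschitz
  -- constant does not grow.
  · refine LipschitzWith.of_le_add_mul K fun x y ↦ ?_
    have h1 : g y + K * dist x y = ∫ t, (φ.normed μ t * f (y - t) +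
        φ.normed μ t * (K * dist x y)) ∂μ := by
      rw [integral_add (hex y) (φ.integrable_normed.mul_const _), integral_mul_const,
        φ.integral_normed, one_mul, hgx]
    rw [h1, hgx]
    refine integral_mono (hex x) ((hex y).add (φ.integrable_normed.mul_const _)) fun t ↦ ?_
    have h2 := hf.le_add_mul (x - t) (y - t)
    rw [dist_sub_right] at h2
    have := mul_le_mul_of_nonneg_left h2 (φ.nonneg_normed (μ := μ) t)
    rw [mul_add] at this
    exact this
  · refine φ.dist_normed_convolution_le hf.continuous.aestronglyMeasurable fun x hx ↦ ?_
    refine (hf.dist_le_mul x a).trans (le_trans ?_ hKδ)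
    gcongr
    exact (Metric.mem_ball.1 hx).le

end Mollification

/-! ### Rules for the differential -/

section Differential

variable {n : ℕ} {M : Type*} [TopologicalSpace M] [ChartedSpace (EuclideanSpace ℝ (Fin n)) M]

lemma differential_const (c : ℝ) (x : M) : differential n (fun _ : M ↦ c) x = 0 :=
  mfderiv_const

lemma differential_add {f g : M → ℝ} {x : M}
    (hf : MDifferentiableAt 𝓘(ℝ, EuclideanSpace ℝ (Fin n)) 𝓘(ℝ, ℝ) f x)
    (hg : MDifferentiableAt 𝓘(ℝ, EuclideanSpace ℝ (Fin n)) 𝓘(ℝ, ℝ) g x) :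
    differential n (fun y ↦ f y + g y) x = differential n f x + differential n g x :=
  (hf.hasMFDerivAt.add hg.hasMFDerivAt).mfderiv

lemma differential_sub {f g : M → ℝ} {x : M}
    (hf : MDifferentiableAt 𝓘(ℝ, EuclideanSpace ℝ (Fin n)) 𝓘(ℝ, ℝ) f x)
    (hg : MDifferentiableAt 𝓘(ℝ, EuclideanSpace ℝ (Fin n)) 𝓘(ℝ, ℝ) g x) :
    differential n (fun y ↦ f y - g y) x = differential n f x - differential n g x :=
  (hf.hasMFDerivAt.sub hg.hasMFDerivAt).mfderiv

lemma differential_mul {f g : M → ℝ} {x : M}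
    (hf : MDifferentiableAt 𝓘(ℝ, EuclideanSpace ℝ (Fin n)) 𝓘(ℝ, ℝ) f x)
    (hg : MDifferentiableAt 𝓘(ℝ, EuclideanSpace ℝ (Fin n)) 𝓘(ℝ, ℝ) g x) :
    differential n (fun y ↦ f y * g y) x = f x • differential n g x + g x • differential n f x :=
  (hf.hasMFDerivAt.mul hg.hasMFDerivAt).mfderiv

lemma differential_sum {ι : Type*} {t : Finset ι} {f : ι → M → ℝ} {x : M}
    (hf : ∀ i ∈ t, MDifferentiableAt 𝓘(ℝ, EuclideanSpace ℝ (Fin n)) 𝓘(ℝ, ℝ) (f i) x) :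
    MDifferentiableAt 𝓘(ℝ, EuclideanSpace ℝ (Fin n)) 𝓘(ℝ, ℝ) (fun y ↦ ∑ i ∈ t, f i y) x ∧
    differential n (fun y ↦ ∑ i ∈ t, f i y) x = ∑ i ∈ t, differential n (f i) x := by
  classical
  induction t using Finset.induction_on with
  | empty => exact ⟨by simpa using mdifferentiableAt_const, by simpa using differential_const 0 x⟩
  | insert a t ha ih =>
    have h1 := ih fun i hi ↦ hf i (Finset.mem_insert_of_mem hi)
    have h2 := hf a (Finset.mem_insert_self a t)
    simp only [Finset.sum_insert ha]
    exact ⟨h2.add h1.1, by rw [differential_add h2 h1.1, h1.2]⟩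

lemma differential_comp {f : M → ℝ} {φ : ℝ → ℝ} {φ' : ℝ} {x : M}
    (hf : MDifferentiableAt 𝓘(ℝ, EuclideanSpace ℝ (Fin n)) 𝓘(ℝ, ℝ) f x)
    (hφ : HasDerivAt φ φ' (f x)) :
    differential n (fun y ↦ φ (f y)) x = φ' • differential n f x := by
  have h := HasMFDerivAt.comp x hφ.hasFDerivAt.hasMFDerivAt hf.hasMFDerivAt
  refine h.mfderiv.trans ?_
  ext v
  change differential n f x v * φ' = φ' * differential n f x v
  exact mul_comm _ _

lemma differential_congr {f g : M → ℝ} {x : M} (h : f =ᶠ[𝓝 x] g) :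
    differential n f x = differential n g x :=
  h.mfderiv_eq

end Differential

/-! ### Smoothing a Lipschitz function near a point -/

section LocalApproximation

variable {E : Type*} [NormedAddCommGroup E] [NormedSpace ℝ E] {H : Type*} [TopologicalSpace H]
  (I : ModelWithCorners ℝ E H) {M : Type*} [MetricSpace M] [ChartedSpace H M] [IsManifold I 1 M]

/-- The differential at `c` of the preferred chart at `c`. -/
def chartDifferential (c : M) : TangentSpace I c →L[ℝ] E :=
  (trivializationAt E (TangentSpace I (M := M)) c).continuousLinearMapAt ℝ c

/-- The inverse of the differential at `c` of the preferred chart at `c`. -/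
def chartDifferentialSymm (c : M) : E →L[ℝ] TangentSpace I c :=
  (trivializationAt E (TangentSpace I (M := M)) c).symmL ℝ c

lemma chartDifferential_chartDifferentialSymm (c : M) (w : E) :
    chartDifferential I c (chartDifferentialSymm I c w) = w :=
  Trivialization.continuousLinearMapAt_symmL _ (FiberBundle.mem_baseSet_trivializationAt' c) w

variable [RiemannianBundle (fun x : M ↦ TangentSpace I x)]
  [IsContinuousRiemannianBundle E (fun x : M ↦ TangentSpace I x)]

/-- In the linear coordinates given by the tangent space at `c`, the distance is locally bounded by
`r > 1` times the norm of the tangent space at `c`. -/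
lemma exists_ball_edist_symm_le [I.Boundaryless] [IsRiemannianManifold I M] (c : M)
    {r : NNReal} (hr : 1 < r) :
    ∃ δ > 0, ∀ u ∈ Metric.ball (chartDifferentialSymm I c (extChartAt I c c)) δ,
      ∀ v ∈ Metric.ball (chartDifferentialSymm I c (extChartAt I c c)) δ,
      edist ((extChartAt I c).symm (chartDifferential I c u))
        ((extChartAt I c).symm (chartDifferential I c v)) ≤ r * edist u v := by
  set φ := extChartAt I c with hφ
  set D := chartDifferential I c with hD
  set e := trivializationAt E (TangentSpace I (M := M)) c with he
  -- Continuity of the metric: identifying the tangent space at `c` with a nearby one through the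
  -- chart distorts norms by a factor less than r.
  have key : ∀ᶠ y in 𝓝 c, ‖(e.symmL ℝ y) ∘L D‖ < r :=
    eventually_norm_symmL_trivializationAt_comp_self_lt E
      (fun x : M ↦ TangentSpace I x) c (by exact_mod_cast hr)
  have h1 : ∀ᶠ w in 𝓝 (φ c), w ∈ φ.target ∧ ‖(e.symmL ℝ (φ.symm w)) ∘L D‖ < r := by
    refine Filter.Eventually.and (extChartAt_target_mem_nhds c) ?_
    have hc : Tendsto φ.symm (𝓝 (φ c)) (𝓝 c) := by
      have := continuousAt_extChartAt_symm (I := I) c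
      rwa [ContinuousAt, extChartAt_to_inv c] at this
    exact hc.eventually key
  have h2 : ∀ᶠ u in 𝓝 (chartDifferentialSymm I c (φ c)), D u ∈ φ.target ∧
      ‖(e.symmL ℝ (φ.symm (D u))) ∘L D‖ < r := by
    have hc : Tendsto D (𝓝 (chartDifferentialSymm I c (φ c))) (𝓝 (φ c)) := by
      have := D.continuous.tendsto (chartDifferentialSymm I c (φ c))
      rwa [hD, chartDifferential_chartDifferentialSymm] at this
    exact hc.eventually h1
  obtain ⟨δ, hδ, hball⟩ := Metric.eventually_nhds_iff_ball.1 h2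
  refine ⟨δ, hδ, fun u hu v hv ↦ ?_⟩
  -- The distance is at most the length of the image of the straight segment, whose speed is bounded
  -- by r ‖v - u‖.
  let η := ContinuousAffineMap.lineMap (R := ℝ) (D u) (D v)
  set γ := φ.symm ∘ η with hγ
  have hη : ∀ t ∈ Set.Icc (0 : ℝ) 1, η t ∈ φ.target ∧
      ‖(e.symmL ℝ (φ.symm (η t))) ∘L D‖ < r := by
    intro t ht
    have h3 : AffineMap.lineMap u v t ∈ Metric.ball (chartDifferentialSymm I c (φ c)) δ :=
      (convex_ball _ _).segment_subset hu hv (by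
        rw [segment_eq_image_lineMap]; exact ⟨t, ht, rfl⟩)
    have h4 : η t = D (AffineMap.lineMap u v t) := by
      simp [η, ContinuousAffineMap.coe_lineMap_eq, AffineMap.lineMap_apply]
    rw [h4]
    exact hball _ h3
  have η_smooth : ContMDiffOn 𝓘(ℝ, ℝ) 𝓘(ℝ, E) 1 η (Set.Icc 0 1) := by
    apply ContMDiff.contMDiffOn
    rw [contMDiff_iff_contDiff]
    exact ContinuousAffineMap.contDiff _
  rw [IsRiemannianManifold.out (I := I)]
  have hlen : Manifold.riemannianEDist I (φ.symm (D u)) (φ.symm (D v)) ≤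
      Manifold.pathELength I γ 0 1 := by
    apply Manifold.riemannianEDist_le_pathELength _ _ _ zero_le_one
    · exact (contMDiffOn_extChartAt_symm c).comp η_smooth fun t ht ↦ (hη t ht).1
    · simp [γ, η, ContinuousAffineMap.coe_lineMap_eq]
    · simp [γ, η, ContinuousAffineMap.coe_lineMap_eq]
  refine hlen.trans ?_
  have hint : (r : ENNReal) * edist u v = ∫⁻ _ in Set.Icc (0 : ℝ) 1, r * edist u v := by simp
  rw [Manifold.pathELength_eq_lintegral_mfderivWithin_Icc, hint]
  refine setLIntegral_mono' measurableSet_Icc fun t ht ↦ ?_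
  have hd : mfderivWithin 𝓘(ℝ, ℝ) I γ (Set.Icc 0 1) t =
      (mfderivWithin 𝓘(ℝ, E) I φ.symm (Set.range I) (η t)) ∘L
        (mfderivWithin 𝓘(ℝ, ℝ) 𝓘(ℝ, E) η (Set.Icc 0 1) t) := by
    apply mfderivWithin_comp
    · exact mdifferentiableWithinAt_extChartAt_symm (hη t ht).1
    · exact η_smooth.mdifferentiableOn one_ne_zero t ht
    · exact fun s hs ↦ extChartAt_target_subset_range c (hη s hs).1
    · rw [uniqueMDiffWithinAt_iff_uniqueDiffWithinAt]
      exact uniqueDiffOn_Icc zero_lt_one t ht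
  have hline : ∀ a b : E, fderiv ℝ (ContinuousAffineMap.lineMap (R := ℝ) a b) t (1 : ℝ) = b - a :=
    fun a b ↦ by simp
  have hηd : mfderivWithin 𝓘(ℝ, ℝ) 𝓘(ℝ, E) η (Set.Icc 0 1) t (1 : ℝ) = D (v - u) := by
    rw [mfderivWithin_eq_fderivWithin, fderivWithin_eq_fderiv (uniqueDiffOn_Icc zero_lt_one _ ht)
      (ContinuousAffineMap.differentiableAt _)]
    exact (hline _ _).trans (map_sub D v u).symm
  have hsrc : φ.symm (η t) ∈ (chartAt H c).source := by
    have := φ.map_target (hη t ht).1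
    rwa [hφ, extChartAt_source] at this
  have hsymm : ∀ w : E, (e.symmL ℝ (φ.symm (η t)) w : E) =
      (mfderivWithin 𝓘(ℝ, E) I φ.symm (Set.range I) (η t) : E →L[ℝ] E) w := fun w ↦ by
    have h3 := congrArg (fun q : E ↦ (mfderivWithin 𝓘(ℝ, E) I φ.symm (Set.range I) q : E →L[ℝ] E) w)
      (φ.right_inv (hη t ht).1)
    exact (DFunLike.congr_fun (TangentBundle.symmL_trivializationAt (I := I) hsrc) w).trans h3
  have hval : mfderivWithin 𝓘(ℝ, ℝ) I γ (Set.Icc 0 1) t (1 : ℝ) =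
      ((e.symmL ℝ (φ.symm (η t))) ∘L D) (v - u) := by
    have h3 : mfderivWithin 𝓘(ℝ, ℝ) I γ (Set.Icc 0 1) t (1 : ℝ) =
      (mfderivWithin 𝓘(ℝ, E) I φ.symm (Set.range I) (η t))
        (mfderivWithin 𝓘(ℝ, ℝ) 𝓘(ℝ, E) η (Set.Icc 0 1) t (1 : ℝ)) := DFunLike.congr_fun hd (1 : ℝ)
    exact h3.trans ((congrArg _ hηd).trans (hsymm _).symm)
  have hfin : ‖((e.symmL ℝ (φ.symm (η t))) ∘L D) (v - u)‖ ≤ r * ‖v - u‖ :=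
    (ContinuousLinearMap.le_opNorm _ _).trans
      (mul_le_mul_of_nonneg_right (hη t ht).2.le (norm_nonneg _))
  have hfin' : ‖mfderivWithin 𝓘(ℝ, ℝ) I γ (Set.Icc 0 1) t (1 : ℝ)‖ₑ ≤ r * edist u v := by
    rw [hval, edist_comm, edist_eq_enorm_sub, ← ofReal_norm, ← ofReal_norm,
      ← ENNReal.ofReal_coe_nnreal, ← ENNReal.ofReal_mul r.coe_nonneg]
    exact ENNReal.ofReal_le_ofReal hfin
  exact hfin'

/-- Around every point, a `1`-Lipschitz function is a uniform limit of smooth functions with gradient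
of length at most `r ^ 2`, where `r > 1` is arbitrary. -/
lemma exists_contMDiff_gradNorm_le_of_lipschitzWith {n : ℕ} {M : Type*} [MetricSpace M]
    [ChartedSpace (EuclideanSpace ℝ (Fin n)) M] [IsManifold 𝓘(ℝ, EuclideanSpace ℝ (Fin n)) ∞ M]
    [RiemannianBundle (fun x : M ↦ TangentSpace 𝓘(ℝ, EuclideanSpace ℝ (Fin n)) x)]
    [IsContinuousRiemannianBundle (EuclideanSpace ℝ (Fin n))
      (fun x : M ↦ TangentSpace 𝓘(ℝ, EuclideanSpace ℝ (Fin n)) x)]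
    [IsRiemannianManifold 𝓘(ℝ, EuclideanSpace ℝ (Fin n)) M] {F : M → ℝ} (hF : LipschitzWith 1 F)
    (c : M) {r : NNReal} (hr : 1 < r) :
    ∃ U : Set M, IsOpen U ∧ c ∈ U ∧ ∀ ε > 0, ∃ G : M → ℝ,
      ContMDiff 𝓘(ℝ, EuclideanSpace ℝ (Fin n)) 𝓘(ℝ, ℝ) ∞ G ∧
      ∀ y ∈ U, |G y - F y| ≤ ε ∧ gradNorm n G y ≤ r * r := by
  obtain ⟨δ, hδ, hball⟩ := exists_ball_edist_symm_le 𝓘(ℝ, EuclideanSpace ℝ (Fin n)) c hr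
  set φ := extChartAt 𝓘(ℝ, EuclideanSpace ℝ (Fin n)) c with hφ
  set D := chartDifferential 𝓘(ℝ, EuclideanSpace ℝ (Fin n)) c with hD
  set S := chartDifferentialSymm 𝓘(ℝ, EuclideanSpace ℝ (Fin n)) c with hS
  have : FiniteDimensional ℝ (TangentSpace 𝓘(ℝ, EuclideanSpace ℝ (Fin n)) c) :=
    inferInstanceAs (FiniteDimensional ℝ (EuclideanSpace ℝ (Fin n)))
  -- One factor r comes from reading F in the linear coordinates of the tangent space at `c`;
  -- extension and mollification preserve it. The other comes from the differential of these
  -- coordinates, bounded in `hder`.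
  have f_lip : LipschitzOnWith r (fun u ↦ F (φ.symm (D u))) (Metric.ball (S (φ c)) δ) :=
    fun u hu v hv ↦ (hF.edist_le_mul _ _).trans (by simpa using hball u hu v hv)
  obtain ⟨f, hf, hfeq⟩ := f_lip.extend_real
  have hder : ∀ᶠ y in 𝓝 c, ‖S ∘L ((trivializationAt (EuclideanSpace ℝ (Fin n))
      (TangentSpace 𝓘(ℝ, EuclideanSpace ℝ (Fin n)) (M := M)) c).continuousLinearMapAt ℝ y)‖ < r :=
    eventually_norm_symmL_trivializationAt_self_comp_lt (EuclideanSpace ℝ (Fin n))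
      (fun x : M ↦ TangentSpace 𝓘(ℝ, EuclideanSpace ℝ (Fin n)) x) c (by exact_mod_cast hr)
  obtain ⟨ψ⟩ : Nonempty (SmoothBumpFunction 𝓘(ℝ, EuclideanSpace ℝ (Fin n)) c) := inferInstance
  have hmem : ∀ᶠ y in 𝓝 c, S (φ y) ∈ Metric.ball (S (φ c)) δ := by
    have hcont : ContinuousAt (fun y ↦ S (φ y)) c :=
      S.continuous.continuousAt.comp (continuousAt_extChartAt c)
    exact hcont.eventually (Metric.ball_mem_nhds _ hδ)
  have hsource : ∀ᶠ y in 𝓝 c, y ∈ (chartAt (EuclideanSpace ℝ (Fin n)) c).source :=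
    chart_source_mem_nhds _ c
  obtain ⟨U, hU, U_open, hcU⟩ := eventually_nhds_iff.1
    (hsource.and (hmem.and (hder.and ψ.eventuallyEq_one.eventually_nhds)))
  -- The neighbourhood is fixed before ε, so that a partition of unity can later be chosen before
  -- the accuracy. The bump is 1 near each point of U and leaves values and differentials there
  -- unchanged.
  refine ⟨U, U_open, hcU, fun ε hε ↦ ?_⟩
  obtain ⟨g, g_smooth, g_lip, hg⟩ := exists_contDiff_lipschitzWith_dist_le hf hε
  have gS_smooth : ContDiff ℝ ∞ (fun w : EuclideanSpace ℝ (Fin n) ↦ g (S w)) :=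
    g_smooth.comp S.contDiff
  refine ⟨fun y ↦ ψ y • g (S (φ y)), ψ.contMDiff_smul
    (gS_smooth.contMDiff.comp_contMDiffOn contMDiffOn_extChartAt), fun y hy ↦ ?_⟩
  obtain ⟨hy1, hy2, hy3, hy4⟩ := hU y hy
  constructor
  · have h1 : ψ y = 1 := hy4.self_of_nhds
    have h2 : φ.symm (D (S (φ y))) = y := by
      rw [hD, hS, chartDifferential_chartDifferentialSymm, hφ]
      exact (extChartAt 𝓘(ℝ, EuclideanSpace ℝ (Fin n)) c).left_inv (by rwa [extChartAt_source])
    have h3 : F y = f (S (φ y)) := by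
      rw [← hfeq hy2]
      beta_reduce
      rw [h2]
    beta_reduce
    rw [h1, one_smul, h3]
    exact hg _
  · have h1 : (fun z ↦ ψ z • g (S (φ z))) =ᶠ[𝓝 y] fun z ↦ g (S (φ z)) := by
      filter_upwards [hy4] with z hz
      simp [hz]
    have h2 : HasMFDerivAt 𝓘(ℝ, EuclideanSpace ℝ (Fin n)) 𝓘(ℝ, ℝ) (fun z ↦ g (S (φ z))) y
        ((fderiv ℝ g (S (φ y)) ∘L S) ∘L
          mfderiv 𝓘(ℝ, EuclideanSpace ℝ (Fin n)) 𝓘(ℝ, EuclideanSpace ℝ (Fin n)) φ y) := by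
      have h3 : HasFDerivAt (fun w ↦ g (S w)) (fderiv ℝ g (S (φ y)) ∘L S) (φ y) :=
        ((g_smooth.differentiable (by simp)) _).hasFDerivAt.comp _ S.hasFDerivAt
      exact HasMFDerivAt.comp (g := fun w ↦ g (S w)) y h3.hasMFDerivAt
        (mdifferentiableAt_extChartAt hy1).hasMFDerivAt
    have h4 : differential n (fun z ↦ ψ z • g (S (φ z))) y = (fderiv ℝ g (S (φ y))) ∘L
        (S ∘L ((trivializationAt (EuclideanSpace ℝ (Fin n))
          (TangentSpace 𝓘(ℝ, EuclideanSpace ℝ (Fin n)) (M := M)) c).continuousLinearMapAt ℝ y)) := by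
      rw [differential_congr h1]
      refine h2.mfderiv.trans ?_
      rw [TangentBundle.continuousLinearMapAt_trivializationAt hy1]
      rfl
    rw [gradNorm, h4]
    refine (ContinuousLinearMap.opNorm_comp_le _ _).trans ?_
    gcongr
    exact norm_fderiv_le_of_lipschitz ℝ g_lip

end LocalApproximation

/-! ### Global smoothing with control of the gradient -/

section GlobalApproximation

lemma differential_of_notMem_tsupport {n : ℕ} {M : Type*} [TopologicalSpace M]
    [ChartedSpace (EuclideanSpace ℝ (Fin n)) M]
    {f : M → ℝ} {x : M} (hx : x ∉ tsupport f) : differential n f x = 0 := by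
  rw [differential_congr (notMem_tsupport_iff_eventuallyEq.1 hx)]
  exact differential_const 0 x

section Norm

variable {n : ℕ} {M : Type*} [TopologicalSpace M] [ChartedSpace (EuclideanSpace ℝ (Fin n)) M]
  [RiemannianBundle (fun x : M ↦ TangentSpace 𝓘(ℝ, EuclideanSpace ℝ (Fin n)) x)] {x : M}

lemma norm_covector_zero :
    ‖(0 : TangentSpace 𝓘(ℝ, EuclideanSpace ℝ (Fin n)) x →L[ℝ] ℝ)‖ = 0 :=
  ContinuousLinearMap.opNorm_zero

lemma norm_covector_nonneg (a : TangentSpace 𝓘(ℝ, EuclideanSpace ℝ (Fin n)) x →L[ℝ] ℝ) :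
    0 ≤ ‖a‖ :=
  ContinuousLinearMap.opNorm_nonneg a

lemma norm_covector_add_le (a b : TangentSpace 𝓘(ℝ, EuclideanSpace ℝ (Fin n)) x →L[ℝ] ℝ) :
    ‖a + b‖ ≤ ‖a‖ + ‖b‖ :=
  ContinuousLinearMap.opNorm_add_le a b

lemma norm_covector_smul_le (c : ℝ)
    (a : TangentSpace 𝓘(ℝ, EuclideanSpace ℝ (Fin n)) x →L[ℝ] ℝ) : ‖c • a‖ ≤ |c| * ‖a‖ :=
  ContinuousLinearMap.opNorm_smul_le c a

lemma norm_covector_sum_le {ι : Type*} (t : Finset ι)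
    (a : ι → TangentSpace 𝓘(ℝ, EuclideanSpace ℝ (Fin n)) x →L[ℝ] ℝ) :
    ‖∑ i ∈ t, a i‖ ≤ ∑ i ∈ t, ‖a i‖ :=
  Finset.le_sum_of_subadditive (fun a : TangentSpace 𝓘(ℝ, EuclideanSpace ℝ (Fin n)) x →L[ℝ] ℝ ↦ ‖a‖)
    norm_covector_zero.le norm_covector_add_le t a

end Norm

variable {n : ℕ} {M : Type*} [MetricSpace M]
  [ChartedSpace (EuclideanSpace ℝ (Fin n)) M] [IsManifold 𝓘(ℝ, EuclideanSpace ℝ (Fin n)) ∞ M]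
  [RiemannianBundle (fun x : M ↦ TangentSpace 𝓘(ℝ, EuclideanSpace ℝ (Fin n)) x)]
  [IsContinuousRiemannianBundle (EuclideanSpace ℝ (Fin n))
    (fun x : M ↦ TangentSpace 𝓘(ℝ, EuclideanSpace ℝ (Fin n)) x)]

/-- In the chart at `c` the differential factors into the coordinate derivative, which is
continuous, a fixed linear map, and a map of norm less than 2 near `c` by continuity of the metric.
-/
lemma eventually_gradNorm_le {f : M → ℝ}
    (hf : ContMDiff 𝓘(ℝ, EuclideanSpace ℝ (Fin n)) 𝓘(ℝ, ℝ) ∞ f) (c : M) :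
    ∃ B, ∀ᶠ y in 𝓝 c, gradNorm n f y ≤ B := by
  set φ := extChartAt 𝓘(ℝ, EuclideanSpace ℝ (Fin n)) c with hφ
  set D := chartDifferential 𝓘(ℝ, EuclideanSpace ℝ (Fin n)) c with hD
  set S := chartDifferentialSymm 𝓘(ℝ, EuclideanSpace ℝ (Fin n)) c with hS
  set h : EuclideanSpace ℝ (Fin n) → ℝ := fun w ↦ f (φ.symm w) with hh
  have hder : ∀ᶠ y in 𝓝 c, ‖S ∘L ((trivializationAt (EuclideanSpace ℝ (Fin n))
      (TangentSpace 𝓘(ℝ, EuclideanSpace ℝ (Fin n)) (M := M)) c).continuousLinearMapAt ℝ y)‖ < 2 :=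
    eventually_norm_symmL_trivializationAt_self_comp_lt (EuclideanSpace ℝ (Fin n))
      (fun x : M ↦ TangentSpace 𝓘(ℝ, EuclideanSpace ℝ (Fin n)) x) c one_lt_two
  have h_smooth : ContDiffOn ℝ ∞ h φ.target :=
    (hf.comp_contMDiffOn (contMDiffOn_extChartAt_symm c)).contDiffOn
  have hsource : ∀ᶠ y in 𝓝 c, y ∈ (chartAt (EuclideanSpace ℝ (Fin n)) c).source :=
    chart_source_mem_nhds _ c
  have hopen : IsOpen φ.target := isOpen_extChartAt_target c
  have hcont : ContinuousAt (fun y ↦ ‖fderiv ℝ h (φ y)‖) c :=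
    ((((h_smooth.continuousOn_fderiv_of_isOpen hopen (by simp)).continuousAt
      (extChartAt_target_mem_nhds c)).comp (continuousAt_extChartAt c))).norm
  refine ⟨(‖fderiv ℝ h (φ c)‖ + 1) * ‖D‖ * 2, ?_⟩
  filter_upwards [hder, hsource.eventually_nhds, hcont.eventually_le_const (lt_add_one _)]
    with y hy1 hy2 hy3
  have hy4 := hy2.self_of_nhds
  have hmem : φ y ∈ φ.target := φ.map_source (by rwa [hφ, extChartAt_source])
  have hfd : HasFDerivAt h (fderiv ℝ h (φ y)) (φ y) :=
    ((h_smooth.contDiffAt (hopen.mem_nhds hmem)).differentiableAt (by simp)).hasFDerivAt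
  have h1 : f =ᶠ[𝓝 y] fun z ↦ h (φ z) := by
    filter_upwards [hy2] with z hz
    rw [hh, hφ]
    beta_reduce
    rw [(extChartAt 𝓘(ℝ, EuclideanSpace ℝ (Fin n)) c).left_inv (by rwa [extChartAt_source])]
  have h2 : HasMFDerivAt 𝓘(ℝ, EuclideanSpace ℝ (Fin n)) 𝓘(ℝ, ℝ) (fun z ↦ h (φ z)) y
      (fderiv ℝ h (φ y) ∘L
        mfderiv 𝓘(ℝ, EuclideanSpace ℝ (Fin n)) 𝓘(ℝ, EuclideanSpace ℝ (Fin n)) φ y) :=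
    HasMFDerivAt.comp (g := h) y hfd.hasMFDerivAt (mdifferentiableAt_extChartAt hy4).hasMFDerivAt
  have h3 : differential n f y = (fderiv ℝ h (φ y) ∘L D) ∘L
      (S ∘L ((trivializationAt (EuclideanSpace ℝ (Fin n))
        (TangentSpace 𝓘(ℝ, EuclideanSpace ℝ (Fin n)) (M := M)) c).continuousLinearMapAt ℝ y)) := by
    rw [differential_congr h1]
    refine h2.mfderiv.trans ?_
    rw [TangentBundle.continuousLinearMapAt_trivializationAt hy4]
    ext v
    exact (congrArg (fderiv ℝ h (φ y)) (chartDifferential_chartDifferentialSymm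
      𝓘(ℝ, EuclideanSpace ℝ (Fin n)) c _)).symm
  rw [gradNorm, h3]
  refine (ContinuousLinearMap.opNorm_comp_le _ _).trans ?_
  gcongr
  refine (ContinuousLinearMap.opNorm_comp_le _ _).trans ?_
  gcongr

lemma exists_forall_gradNorm_le {f : M → ℝ}
    (hf : ContMDiff 𝓘(ℝ, EuclideanSpace ℝ (Fin n)) 𝓘(ℝ, ℝ) ∞ f) (hfc : HasCompactSupport f) :
    ∃ B, 0 ≤ B ∧ ∀ y, gradNorm n f y ≤ B := by
  have h : ∃ B, ∀ y ∈ tsupport f, gradNorm n f y ≤ B := by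
    refine hfc.isCompact.induction_on (p := fun s ↦ ∃ B, ∀ y ∈ s, gradNorm n f y ≤ B) ⟨0, by simp⟩
      (fun s t hst ⟨B, hB⟩ ↦ ⟨B, fun y hy ↦ hB y (hst hy)⟩)
      (fun s t ⟨B, hB⟩ ⟨B', hB'⟩ ↦ ⟨max B B', fun y hy ↦ ?_⟩) fun c _ ↦ ?_
    · rcases hy with hy | hy
      · exact (hB y hy).trans (le_max_left _ _)
      · exact (hB' y hy).trans (le_max_right _ _)
    · obtain ⟨B, hB⟩ := eventually_gradNorm_le hf c
      exact ⟨_, mem_nhdsWithin_of_mem_nhds hB, B, fun y hy ↦ hy⟩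
  obtain ⟨B, hB⟩ := h
  refine ⟨max B 0, le_max_right _ _, fun y ↦ ?_⟩
  by_cases hy : y ∈ tsupport f
  · exact (hB y hy).trans (le_max_left _ _)
  · rw [gradNorm, differential_of_notMem_tsupport hy, norm_covector_zero]
    exact le_max_right _ _

/-- A compactly supported `1`-Lipschitz function on a Riemannian manifold is a uniform limit of
compactly supported smooth functions with gradient of length at most `1 + ε`. -/
theorem exists_contMDiff_hasCompactSupport_gradNorm_le [SecondCountableTopology M]
    [IsRiemannianManifold 𝓘(ℝ, EuclideanSpace ℝ (Fin n)) M] {F : M → ℝ} (hF : LipschitzWith 1 F)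
    (hFc : HasCompactSupport F) {ε : ℝ} (hε : 0 < ε) :
    ∃ G : M → ℝ, ContMDiff 𝓘(ℝ, EuclideanSpace ℝ (Fin n)) 𝓘(ℝ, ℝ) ∞ G ∧ HasCompactSupport G ∧
      (∀ y, |G y - F y| ≤ ε) ∧ ∀ y, gradNorm n G y ≤ 1 + ε := by
  have : LocallyCompactSpace M :=
    Manifold.locallyCompact_of_finiteDimensional 𝓘(ℝ, EuclideanSpace ℝ (Fin n))
  obtain ⟨r, hr1, hr2⟩ : ∃ r : NNReal, 1 < r ∧ (r : ℝ) * r ≤ 1 + ε / 2 := by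
    refine ⟨⟨√(1 + ε / 2), Real.sqrt_nonneg _⟩, ?_, ?_⟩
    · have h1 : (1 : ℝ) < √(1 + ε / 2) := Real.lt_sqrt_of_sq_lt (by linarith)
      exact h1
    · exact (Real.mul_self_sqrt (by positivity)).le
  choose U U_open mem_U hU using
    fun c : M ↦ exists_contMDiff_gradNorm_le_of_lipschitzWith (n := n) hF c hr1
  choose Q Q_compact Q_nhds using fun c : M ↦ exists_compact_mem_nhds c
  obtain ⟨t, ht⟩ := hFc.isCompact.elim_finite_subcover (fun c ↦ U c ∩ interior (Q c))
    (fun c ↦ (U_open c).inter isOpen_interior)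
    fun c _ ↦ Set.mem_iUnion.2 ⟨c, mem_U c, mem_interior_iff_mem_nhds.2 (Q_nhds c)⟩
  -- The index `none` stands for the region off the support of F, where the approximation is 0; the
  -- sets `Q c` keep the other pieces compactly supported.
  let W : Option t → Set M := fun i ↦ i.elim (tsupport F)ᶜ fun c ↦ U c ∩ interior (Q c)
  obtain ⟨ρ, hρ⟩ := SmoothPartitionOfUnity.exists_isSubordinate 𝓘(ℝ, EuclideanSpace ℝ (Fin n))
    (s := Set.univ) isClosed_univ W
    (by
      rintro (_ | c)
      · exact (isClosed_tsupport F).isOpen_compl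
      · exact (U_open c).inter isOpen_interior)
    (by
      intro x _
      by_cases hx : x ∈ tsupport F
      · obtain ⟨c, hc, hxc⟩ := Set.mem_iUnion₂.1 (ht hx)
        exact Set.mem_iUnion.2 ⟨some ⟨c, hc⟩, hxc⟩
      · exact Set.mem_iUnion.2 ⟨none, hx⟩)
  have ρ_smooth : ∀ i, ContMDiff 𝓘(ℝ, EuclideanSpace ℝ (Fin n)) 𝓘(ℝ, ℝ) ∞ (ρ i) :=
    fun i ↦ (ρ i).contMDiff
  have ρ_sum : ∀ y, ρ none y + ∑ i : t, ρ (some i) y = 1 := fun y ↦ by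
    have := ρ.sum_eq_one (Set.mem_univ y)
    rwa [finsum_eq_sum_of_fintype, Fintype.sum_option] at this
  have ρ_compact : ∀ i : t, HasCompactSupport (ρ (some i)) := fun i ↦
    (Q_compact i).of_isClosed_subset (isClosed_tsupport _)
      ((hρ (some i)).trans (Set.inter_subset_right.trans interior_subset))
  choose B B_nonneg hB using fun i : t ↦ exists_forall_gradNorm_le (ρ_smooth (some i)) (ρ_compact i)
  set Bs := ∑ i : t, B i with hBs
  have Bs_nonneg : 0 ≤ Bs := Finset.sum_nonneg fun i _ ↦ B_nonneg i
  -- The gradients of the partition may be large, but they are fixed by now; η makes their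
  -- contribution at most ε / 2, the other ε / 2 being spent on r².
  obtain ⟨η, hη, hη1, hη2⟩ : ∃ η : ℝ, 0 < η ∧ η ≤ ε ∧ η * Bs ≤ ε / 2 := by
    refine ⟨min ε (ε / 2 / (Bs + 1)), by positivity, min_le_left _ _, ?_⟩
    refine (mul_le_mul_of_nonneg_right (min_le_right _ _) Bs_nonneg).trans ?_
    rw [div_mul_eq_mul_div, div_le_iff₀ (by positivity)]
    nlinarith
  choose g g_smooth hg using fun i : t ↦ hU i η hη
  -- the two cases for the terms of the sum
  have term : ∀ (i : t) (y : M), y ∉ U i → ρ (some i) y = 0 ∧ differential n (ρ (some i)) y = 0 :=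
    fun i y hy ↦ by
      have h1 : y ∉ tsupport (ρ (some i)) := fun h ↦ hy (hρ (some i) h).1
      exact ⟨image_eq_zero_of_notMem_tsupport h1, differential_of_notMem_tsupport h1⟩
  have none_term : ∀ y, F y * ρ none y = 0 ∧ F y • differential n (ρ none) y = 0 := fun y ↦ by
    by_cases hy : F y = 0
    · simp [hy]
    · have h1 : y ∉ tsupport (ρ none) := fun h ↦ hρ none h (subset_tsupport F hy)
      rw [image_eq_zero_of_notMem_tsupport h1, differential_of_notMem_tsupport h1]
      simp
  have mdiff : ∀ {f : M → ℝ}, ContMDiff 𝓘(ℝ, EuclideanSpace ℝ (Fin n)) 𝓘(ℝ, ℝ) ∞ f → ∀ y,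
      MDifferentiableAt 𝓘(ℝ, EuclideanSpace ℝ (Fin n)) 𝓘(ℝ, ℝ) f y := fun hf y ↦
    (hf y).mdifferentiableAt (by simp)
  refine ⟨fun y ↦ ∑ i : t, ρ (some i) y * g i y, ?_, ?_, fun y ↦ ?_, fun y ↦ ?_⟩
  · exact contMDiff_finsetSum fun i _ ↦ (ρ_smooth (some i)).mul (g_smooth i)
  · refine HasCompactSupport.intro (t.isCompact_biUnion fun c _ ↦ Q_compact c) fun y hy ↦
      Finset.sum_eq_zero fun i _ ↦ ?_
    have h1 : y ∉ tsupport (ρ (some i)) := fun h ↦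
      hy (Set.mem_iUnion₂.2 ⟨i, i.2, interior_subset (hρ (some i) h).2⟩)
    rw [image_eq_zero_of_notMem_tsupport h1, zero_mul]
  · have h1 : ∑ i : t, ρ (some i) y * g i y - F y = ∑ i : t, ρ (some i) y * (g i y - F y) := by
      have h2 : F y = F y * (ρ none y + ∑ i : t, ρ (some i) y) := by rw [ρ_sum, mul_one]
      rw [mul_add, (none_term y).1, zero_add, Finset.mul_sum] at h2
      conv_lhs => rw [h2]
      rw [← Finset.sum_sub_distrib]
      exact Finset.sum_congr rfl fun i _ ↦ by ring
    rw [h1]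
    refine (Finset.abs_sum_le_sum_abs _ _).trans ?_
    have h3 : ∀ i ∈ (Finset.univ : Finset t), |ρ (some i) y * (g i y - F y)| ≤ ρ (some i) y * η :=
      fun i _ ↦ by
        by_cases hy : y ∈ U i
        · rw [abs_mul, abs_of_nonneg (ρ.nonneg _ _)]
          exact mul_le_mul_of_nonneg_left (hg i y hy).1 (ρ.nonneg _ _)
        · simp [(term i y hy).1]
    refine (Finset.sum_le_sum h3).trans ?_
    rw [← Finset.sum_mul]
    have := ρ.nonneg none y
    nlinarith [ρ_sum y]
  · have h1 : ∑ i : t, differential n (ρ (some i)) y = -differential n (ρ none) y := by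
      have h2 := differential_sum (t := Finset.univ) (f := fun i : t ↦ ρ (some i)) (x := y)
        fun i _ ↦ mdiff (ρ_smooth (some i)) y
      have h3 := differential_add (mdiff (ρ_smooth none) y) h2.1
      rw [h2.2] at h3
      have h4 : (fun z ↦ ρ none z + ∑ i : t, ρ (some i) z) = fun _ ↦ (1 : ℝ) := funext ρ_sum
      rw [h4, differential_const] at h3
      exact eq_neg_of_add_eq_zero_right h3.symm
    -- Since the partition sums to 1 and F kills the `none` term, F times the sum of the dρ_i
    -- vanishes. Subtracting it puts the small factor g_i - F in front of dρ_i.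
    have h2 : differential n (fun y ↦ ∑ i : t, ρ (some i) y * g i y) y = ∑ i : t,
        (ρ (some i) y • differential n (g i) y + (g i y - F y) • differential n (ρ (some i)) y) := by
      rw [(differential_sum (t := Finset.univ) (f := fun (i : t) z ↦ ρ (some i) z * g i z) (x := y)
        fun i _ ↦ mdiff ((ρ_smooth (some i)).mul (g_smooth i)) y).2]
      have h3 : ∑ i : t, F y • differential n (ρ (some i)) y = 0 := by
        rw [← Finset.smul_sum, h1, smul_neg, (none_term y).2, neg_zero]
      rw [← sub_zero (∑ i : t, differential n (fun z ↦ ρ (some i) z * g i z) y), ← h3,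
        ← Finset.sum_sub_distrib]
      refine Finset.sum_congr rfl fun i _ ↦ ?_
      rw [differential_mul (mdiff (ρ_smooth (some i)) y) (mdiff (g_smooth i) y)]
      module
    rw [gradNorm, h2]
    have h3 : ∀ i ∈ (Finset.univ : Finset t), ‖ρ (some i) y • differential n (g i) y +
        (g i y - F y) • differential n (ρ (some i)) y‖ ≤ ρ (some i) y * (r * r) + η * B i :=
      fun i _ ↦ by
        by_cases hy : y ∈ U i
        · refine (norm_covector_add_le _ _).trans (add_le_add
            ((norm_covector_smul_le _ _).trans ?_) ((norm_covector_smul_le _ _).trans ?_))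
          · rw [abs_of_nonneg (ρ.nonneg _ _)]
            exact mul_le_mul_of_nonneg_left (hg i y hy).2 (ρ.nonneg _ _)
          · exact mul_le_mul (hg i y hy).1 (hB i y) (norm_covector_nonneg _) hη.le
        · rw [(term i y hy).1, (term i y hy).2, zero_smul, smul_zero, add_zero, norm_covector_zero,
            zero_mul, zero_add]
          exact mul_nonneg hη.le (B_nonneg i)
    refine (norm_covector_sum_le _ _).trans ((Finset.sum_le_sum h3).trans ?_)
    rw [Finset.sum_add_distrib, ← Finset.sum_mul, ← Finset.mul_sum, ← hBs]
    have h4 := ρ.nonneg none y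
    have h5 : (∑ i : t, ρ (some i) y) * (r * r : ℝ) ≤ 1 * (r * r) :=
      mul_le_mul_of_nonneg_right (by linarith [ρ_sum y]) (by positivity)
    linarith

end GlobalApproximation

/-! ### Cutoffs with small gradients and the Dirichlet form -/

section FisherInformation

lemma lipschitzWith_one_const_sub_dist {X : Type*} [PseudoMetricSpace X] (a : ℝ) (x₀ : X) :
    LipschitzWith 1 fun x ↦ a - dist x x₀ :=
  LipschitzWith.of_le_add fun x y ↦ by linarith [dist_triangle y x x₀, dist_comm x y]

lemma lipschitzWith_one_max_zero {X : Type*} [PseudoMetricSpace X] {f : X → ℝ}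
    (hf : LipschitzWith 1 f) : LipschitzWith 1 fun x ↦ max 0 (f x) :=
  hf.const_max 0

lemma lipschitzWith_one_min {X : Type*} [PseudoMetricSpace X] {f g : X → ℝ}
    (hf : LipschitzWith 1 f) (hg : LipschitzWith 1 g) : LipschitzWith 1 fun x ↦ min (f x) (g x) :=
  LipschitzWith.of_le_add fun x y ↦ by
    rw [← min_add_add_right]
    exact min_le_min ((hf.le_add_mul x y).trans_eq (by simp))
      ((hg.le_add_mul x y).trans_eq (by simp))

variable {n : ℕ} {M : Type*} [MetricSpace M]
  [ChartedSpace (EuclideanSpace ℝ (Fin n)) M] [IsManifold 𝓘(ℝ, EuclideanSpace ℝ (Fin n)) ∞ M]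
  [RiemannianBundle (fun x : M ↦ TangentSpace 𝓘(ℝ, EuclideanSpace ℝ (Fin n)) x)]
  [IsContinuousRiemannianBundle (EuclideanSpace ℝ (Fin n))
    (fun x : M ↦ TangentSpace 𝓘(ℝ, EuclideanSpace ℝ (Fin n)) x)]
  [ProperSpace M] [IsRiemannianManifold 𝓘(ℝ, EuclideanSpace ℝ (Fin n)) M]

/-- Smooth compactly supported cutoff functions with small gradients. -/
lemma exists_smooth_cutoff (x₀ : M) : ∃ χ : ℕ → M → ℝ,
    (∀ k, ContMDiff 𝓘(ℝ, EuclideanSpace ℝ (Fin n)) 𝓘(ℝ, ℝ) ∞ (χ k)) ∧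
    (∀ k, HasCompactSupport (χ k)) ∧ (∀ k y, |χ k y| ≤ 2) ∧
    (∀ y, Tendsto (fun k ↦ χ k y) atTop (𝓝 1)) ∧
    ∀ k y, gradNorm n (χ k) y ≤ 2 * (1 / ((k : ℝ) + 1)) := by
  -- A plateau of height k + 1 with slope 1. Smoothing with accuracy 1 makes the gradient at most 2,
  -- and dividing by the height k + 1 makes both gradient and error tend to 0.
  let F : ℕ → M → ℝ := fun k y ↦ max 0 (min ((k : ℝ) + 1) (2 * ((k : ℝ) + 1) - dist y x₀))
  have F_lip : ∀ k, LipschitzWith 1 (F k) := fun k ↦ lipschitzWith_one_max_zero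
    (lipschitzWith_one_min (LipschitzWith.const' _) (lipschitzWith_one_const_sub_dist _ x₀))
  have F_compact : ∀ k, HasCompactSupport (F k) := fun k ↦
    HasCompactSupport.intro (isCompact_closedBall x₀ (2 * ((k : ℝ) + 1))) fun y hy ↦ by
      rw [Metric.mem_closedBall, not_le] at hy
      exact max_eq_left ((min_le_right _ _).trans (by linarith))
  choose G G_smooth G_compact hG G_grad using fun k ↦
    exists_contMDiff_hasCompactSupport_gradNorm_le (n := n) (F_lip k) (F_compact k) zero_lt_one
  have pos : ∀ k : ℕ, (0 : ℝ) < k + 1 := fun k ↦ by positivity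
  have F_le : ∀ k y, 0 ≤ F k y ∧ F k y ≤ k + 1 := fun k y ↦
    ⟨le_max_left _ _, max_le (pos k).le (min_le_left _ _)⟩
  refine ⟨fun k y ↦ G k y * (1 / ((k : ℝ) + 1)), fun k ↦ (G_smooth k).mul contMDiff_const,
    fun k ↦ (G_compact k).mul_right, fun k y ↦ ?_, fun y ↦ ?_, fun k y ↦ ?_⟩
  · rw [abs_mul, abs_of_pos (one_div_pos.2 (pos k)), mul_one_div, div_le_iff₀ (pos k)]
    have h1 := abs_le.1 (hG k y)
    have h2 := F_le k y
    have h3 : (0 : ℝ) ≤ k := k.cast_nonneg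
    rw [abs_le]
    constructor <;> linarith
  · obtain ⟨N, hN⟩ := exists_nat_ge (dist y x₀)
    have h1 : Tendsto (fun k : ℕ ↦ G k y * (1 / ((k : ℝ) + 1)) - 1) atTop (𝓝 0) := by
      refine squeeze_zero_norm' ?_ tendsto_one_div_add_atTop_nhds_zero_nat
      filter_upwards [eventually_ge_atTop N] with k hk
      have hk' : (N : ℝ) ≤ k := by exact_mod_cast hk
      have h2 : F k y = k + 1 := by
        have : min ((k : ℝ) + 1) (2 * ((k : ℝ) + 1) - dist y x₀) = k + 1 :=
          min_eq_left (by linarith)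
        simp only [F]
        rw [this, max_eq_right (pos k).le]
      have h3 : G k y * (1 / ((k : ℝ) + 1)) - 1 = (G k y - F k y) * (1 / ((k : ℝ) + 1)) := by
        rw [h2]
        field_simp
      rw [h3, norm_mul, Real.norm_eq_abs, Real.norm_of_nonneg (one_div_pos.2 (pos k)).le]
      exact mul_le_of_le_one_left (one_div_pos.2 (pos k)).le (hG k y)
    simpa using h1.add_const 1
  · have h1 : differential n (fun y ↦ G k y * (1 / ((k : ℝ) + 1))) y =
        (1 / ((k : ℝ) + 1)) • differential n (G k) y := by
      rw [differential_mul ((G_smooth k y).mdifferentiableAt (by simp)) mdifferentiableAt_const,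
        differential_const, smul_zero, zero_add]
    rw [gradNorm, h1]
    refine (norm_covector_smul_le _ _).trans ?_
    rw [abs_of_pos (one_div_pos.2 (pos k)), mul_comm]
    refine mul_le_mul_of_nonneg_right ?_ (one_div_pos.2 (pos k)).le
    exact (G_grad k y).trans (by norm_num)

variable [MeasurableSpace M] [BorelSpace M]

/-- The sum of a smooth compactly supported function `u` and a constant belongs to the domain of the
Dirichlet form, and its energy is at most the integral of any bound for `|∇u|²`. -/
lemma add_const_mem_dirichletDomain [Nonempty M] {μ : Measure M} [IsProbabilityMeasure μ]
    {u : M → ℝ}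
    (hu : ContMDiff 𝓘(ℝ, EuclideanSpace ℝ (Fin n)) 𝓘(ℝ, ℝ) ∞ u) (huc : HasCompactSupport u)
    (a : ℝ) {w : M → ℝ} (hw : ∀ y, gradNorm n u y ^ 2 ≤ w y) :
    (fun y ↦ u y + a) ∈ dirichletDomain n μ ∧
      dirichletForm n μ (fun y ↦ u y + a) ≤ ∫⁻ y, ENNReal.ofReal (w y) ∂μ := by
  obtain ⟨x₀⟩ := ‹Nonempty M›
  obtain ⟨χ, χ_smooth, χ_compact, χ_bdd, χ_lim, χ_grad⟩ := exists_smooth_cutoff (n := n) x₀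
  obtain ⟨B, B_nonneg, hB⟩ := exists_forall_gradNorm_le hu huc
  -- The constant is replaced by a multiple of the cutoff; the energy it adds, including the cross
  -- term with ∇u, vanishes in the limit because |∇u| is bounded.
  let g : ℕ → M → ℝ := fun k y ↦ u y + a * χ k y
  have mdiff : ∀ {f : M → ℝ}, ContMDiff 𝓘(ℝ, EuclideanSpace ℝ (Fin n)) 𝓘(ℝ, ℝ) ∞ f → ∀ y,
      MDifferentiableAt 𝓘(ℝ, EuclideanSpace ℝ (Fin n)) 𝓘(ℝ, ℝ) f y := fun hf y ↦
    (hf y).mdifferentiableAt (by simp)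
  have aχ_smooth : ∀ k, ContMDiff 𝓘(ℝ, EuclideanSpace ℝ (Fin n)) 𝓘(ℝ, ℝ) ∞ fun y ↦ a * χ k y :=
    fun k ↦ contMDiff_const.mul (χ_smooth k)
  have g_smooth : ∀ k, ContMDiff 𝓘(ℝ, EuclideanSpace ℝ (Fin n)) 𝓘(ℝ, ℝ) ∞ (g k) := fun k ↦
    hu.add (aχ_smooth k)
  have aχ_diff : ∀ k y, differential n (fun y ↦ a * χ k y) y = a • differential n (χ k) y :=
    fun k y ↦ by
      rw [differential_mul mdifferentiableAt_const (mdiff (χ_smooth k) y), differential_const,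
        smul_zero, add_zero]
  have g_diff : ∀ k y, differential n (g k) y = differential n u y + a • differential n (χ k) y :=
    fun k y ↦ by rw [differential_add (mdiff hu y) (mdiff (aχ_smooth k) y), aχ_diff]
  have aχ_le : ∀ k y, ‖a • differential n (χ k) y‖ ≤ 2 * |a| * (1 / ((k : ℝ) + 1)) := fun k y ↦ by
    refine (norm_covector_smul_le _ _).trans ?_
    have := mul_le_mul_of_nonneg_left (χ_grad k y) (abs_nonneg a)
    rw [gradNorm] at this
    linarith
  have u_bdd : ∃ D, ∀ y, |u y| ≤ D := huc.exists_bound_of_continuous hu.continuous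
  obtain ⟨D, hD⟩ := u_bdd
  have mem : MemLp (fun y ↦ u y + a) 2 μ :=
    MemLp.of_bound (hu.continuous.add continuous_const).aestronglyMeasurable (D + |a|)
      (ae_of_all _ fun y ↦ (abs_add_le _ _).trans (by gcongr; exact hD y))
  have approx : IsFormApprox n μ (fun y ↦ u y + a) g := by
    refine ⟨g_smooth, fun k ↦ huc.add (χ_compact k).mul_left, ?_, ?_⟩
    · have hsub : ∀ k, (g k - fun y ↦ u y + a) = fun y ↦ a * (χ k y - 1) := fun k ↦ by
        ext y
        simp only [g, Pi.sub_apply]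
        ring
      simp_rw [hsub, eLpNorm_eq_lintegral_rpow_enorm_toReal two_ne_zero ENNReal.ofNat_ne_top]
      have h1 : Tendsto (fun k ↦ ∫⁻ y, ‖a * (χ k y - 1)‖ₑ ^ (2 : ENNReal).toReal ∂μ) atTop
          (𝓝 (∫⁻ _, 0 ∂μ)) := by
        refine tendsto_lintegral_of_dominated_convergence
          (fun _ ↦ (ENNReal.ofReal (|a| * 3)) ^ (2 : ENNReal).toReal) (fun k ↦ ?_)
          (fun k ↦ ae_of_all _ fun y ↦ ?_) ?_ (ae_of_all _ fun y ↦ ?_)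
        · exact (((continuous_const.mul ((χ_smooth k).continuous.sub continuous_const)).measurable
            |>.enorm).pow_const _)
        · beta_reduce
          rw [← ofReal_norm, norm_mul, Real.norm_eq_abs, Real.norm_eq_abs]
          gcongr
          refine (abs_sub _ _).trans ?_
          have := χ_bdd k y
          rw [abs_one]
          linarith
        · rw [lintegral_const]
          exact ENNReal.mul_ne_top (ENNReal.rpow_ne_top_of_nonneg (by simp) ENNReal.ofReal_ne_top)
            (measure_ne_top _ _)
        · have h2 : Tendsto (fun k ↦ ‖a * (χ k y - 1)‖ₑ) atTop (𝓝 0) := by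
            have := (((χ_lim y).sub_const 1).const_mul a).enorm
            simpa using this
          have h3 := (ENNReal.continuous_rpow_const
            (y := (2 : ENNReal).toReal)).tendsto 0 |>.comp h2
          simpa [Function.comp_def] using h3
      have h4 := (ENNReal.continuous_rpow_const
        (y := 1 / (2 : ENNReal).toReal)).tendsto _ |>.comp h1
      simpa [Function.comp_def] using h4
    · have h1 : ∀ p : ℕ × ℕ, energy n μ (g p.1 - g p.2) ≤ ENNReal.ofReal
          ((2 * |a| * (1 / ((p.1 : ℝ) + 1)) + 2 * |a| * (1 / ((p.2 : ℝ) + 1))) ^ 2) := fun p ↦ by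
        have h2 : ∀ y, gradNorm n (g p.1 - g p.2) y ≤
            2 * |a| * (1 / ((p.1 : ℝ) + 1)) + 2 * |a| * (1 / ((p.2 : ℝ) + 1)) := fun y ↦ by
          have h3 : differential n (g p.1 - g p.2) y =
              a • differential n (χ p.1) y + (-1 : ℝ) • a • differential n (χ p.2) y := by
            refine (differential_sub (mdiff (g_smooth p.1) y) (mdiff (g_smooth p.2) y)).trans ?_
            rw [g_diff, g_diff]
            module
          rw [gradNorm, h3]
          refine (norm_covector_add_le _ _).trans (add_le_add (aχ_le _ _) ?_)
          refine (norm_covector_smul_le _ _).trans ?_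
          simpa using aχ_le p.2 y
        refine (lintegral_mono fun y ↦ ENNReal.ofReal_le_ofReal
          (pow_le_pow_left₀ (norm_covector_nonneg _) (h2 y) 2)).trans ?_
        simp
      have h2 : Tendsto (fun p : ℕ × ℕ ↦ ENNReal.ofReal
          ((2 * |a| * (1 / ((p.1 : ℝ) + 1)) + 2 * |a| * (1 / ((p.2 : ℝ) + 1))) ^ 2)) atTop
          (𝓝 0) := by
        have h3 := (tendsto_one_div_add_atTop_nhds_zero_nat (𝕜 := ℝ)).const_mul (2 * |a|)
        rw [← prod_atTop_atTop_eq]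
        have h4 := ((h3.comp tendsto_fst).add (h3.comp (tendsto_snd (f := atTop (α := ℕ))))).pow 2
        simpa using ENNReal.tendsto_ofReal h4
      exact tendsto_of_tendsto_of_tendsto_of_le_of_le tendsto_const_nhds h2 (fun _ ↦ zero_le) h1
  refine ⟨⟨mem, g, approx⟩, (iInf₂_le g approx).trans ?_⟩
  let c : ℕ → ℝ := fun k ↦ 2 * |a| * (1 / ((k : ℝ) + 1))
  have c_nonneg : ∀ k, 0 ≤ c k := fun k ↦ by positivity
  have c_lim : Tendsto c atTop (𝓝 0) := by
    have := (tendsto_one_div_add_atTop_nhds_zero_nat (𝕜 := ℝ)).const_mul (2 * |a|)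
    rwa [mul_zero] at this
  have energy_le : ∀ k, energy n μ (g k) ≤
      ∫⁻ y, ENNReal.ofReal (w y) ∂μ + ENNReal.ofReal (2 * B * c k + c k ^ 2) := fun k ↦ by
    have h1 : ∀ y, ENNReal.ofReal (gradNorm n (g k) y ^ 2) ≤
        ENNReal.ofReal (w y) + ENNReal.ofReal (2 * B * c k + c k ^ 2) := fun y ↦ by
      have h2 : gradNorm n (g k) y ≤ gradNorm n u y + c k := by
        rw [gradNorm, g_diff]
        exact (norm_covector_add_le _ _).trans (add_le_add le_rfl (aχ_le k y))
      have h3 : 0 ≤ gradNorm n (g k) y := norm_covector_nonneg _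
      have h4 : 0 ≤ gradNorm n u y := norm_covector_nonneg _
      rw [← ENNReal.ofReal_add ((sq_nonneg _).trans (hw y)) (by have := c_nonneg k; positivity)]
      refine ENNReal.ofReal_le_ofReal ((pow_le_pow_left₀ h3 h2 2).trans ?_)
      nlinarith [hw y, mul_le_mul_of_nonneg_right (hB y) (c_nonneg k)]
    refine (lintegral_mono h1).trans ?_
    rw [lintegral_add_right _ measurable_const]
    simp
  have lim : Tendsto (fun k ↦ ∫⁻ y, ENNReal.ofReal (w y) ∂μ +
      ENNReal.ofReal (2 * B * c k + c k ^ 2)) atTop (𝓝 (∫⁻ y, ENNReal.ofReal (w y) ∂μ)) := by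
    have h1 : Tendsto (fun k ↦ 2 * B * c k + c k ^ 2) atTop (𝓝 0) := by
      simpa using (c_lim.const_mul (2 * B)).add (c_lim.pow 2)
    simpa using (ENNReal.tendsto_ofReal h1).const_add (∫⁻ y, ENNReal.ofReal (w y) ∂μ)
  exact (limsup_le_limsup (Eventually.of_forall energy_le)).trans_eq lim.limsup_eq

end FisherInformation

/-! ### From W₁I to Gaussian exponential moments -/

section Herbst

/-- The easy half of duality: for every coupling the difference of means is the integral of F(x) -
F(y), which is at most d(x, y). -/
lemma integral_sub_le_of_wassersteinOne_le {X : Type*} [PseudoMetricSpace X] [MeasurableSpace X]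
    {ν μ : Measure X} {F : X → ℝ} (hF : LipschitzWith 1 F) (hν : Integrable F ν)
    (hμ : Integrable F μ) {S : ℝ} (hS : 0 ≤ S) (h : wassersteinOne ν μ ≤ ENNReal.ofReal S) :
    ∫ x, F x ∂ν - ∫ x, F x ∂μ ≤ S := by
  rw [← ENNReal.ofReal_le_ofReal_iff hS]
  refine le_trans (le_iInf₂ fun γ hγ ↦ ?_) h
  obtain ⟨rfl, rfl⟩ := hγ
  rw [integral_map measurable_fst.aemeasurable hν.1, integral_map measurable_snd.aemeasurable hμ.1,
    ← integral_sub (f := fun p : X × X ↦ F p.1) (g := fun p : X × X ↦ F p.2)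
      (hν.comp_measurable measurable_fst) (hμ.comp_measurable measurable_snd)]
  refine (Real.ofReal_le_enorm _).trans ((enorm_integral_le_lintegral_enorm _).trans
    (lintegral_mono fun p ↦ ?_))
  have := hF p.1 p.2
  rw [ENNReal.coe_one, one_mul, edist_eq_enorm_sub] at this
  exact this

/-- A bound for the mean of `G` under its exponential tilts integrates to a bound for the
cumulant-generating function of `G`. -/
lemma cgf_le_of_integral_tilted_le {X : Type*} [MeasurableSpace X] {μ : Measure X}
    [IsProbabilityMeasure μ] {G : X → ℝ} (hG : AEMeasurable G μ) {B : ℝ} (hB : ∀ x, |G x| ≤ B)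
    {A c : ℝ} (h : ∀ t, 0 ≤ t → ∫ x, G x ∂μ.tilted (fun x ↦ t * G x) ≤ A + c * t) {t : ℝ}
    (ht : 0 ≤ t) : ProbabilityTheory.cgf G μ t ≤ A * t + c * t ^ 2 / 2 := by
  have hexp : ∀ s, s ∈ interior (ProbabilityTheory.integrableExpSet G μ) := fun s ↦ by
    have : ProbabilityTheory.integrableExpSet G μ = Set.univ := Set.eq_univ_of_forall fun s ↦
      ProbabilityTheory.integrable_exp_mul_of_mem_Icc hG (ae_of_all _ fun x ↦ abs_le.1 (hB x))
    rw [this, interior_univ]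
    trivial
  have deriv_φ : ∀ s, HasDerivAt
      (fun s ↦ ProbabilityTheory.cgf G μ s - (A * s + c * s ^ 2 / 2))
      (∫ x, G x ∂μ.tilted (fun x ↦ s * G x) - (A + c * s)) s := fun s ↦ by
    rw [ProbabilityTheory.integral_tilted_mul_self (hexp s)]
    refine (ProbabilityTheory.analyticAt_cgf (hexp s)).differentiableAt.hasDerivAt.sub ?_
    have h1 := ((hasDerivAt_id s).const_mul A).add
      ((((hasDerivAt_id s).pow 2).const_mul c).div_const 2)
    refine h1.congr_deriv ?_
    simp
    ring
  have anti := antitoneOn_of_deriv_nonpos (convex_Ici (0 : ℝ))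
    (fun s _ ↦ (deriv_φ s).continuousAt.continuousWithinAt)
    (fun s _ ↦ (deriv_φ s).differentiableAt.differentiableWithinAt) (fun s hs ↦ by
      rw [(deriv_φ s).deriv]
      exact sub_nonpos.2 (h s (interior_subset hs)))
  have := anti Set.self_mem_Ici (Set.mem_Ici.2 ht) ht
  simp only [ProbabilityTheory.cgf_zero] at this
  linarith

section Fisher

variable {n : ℕ} {M : Type*} [MetricSpace M]
  [ChartedSpace (EuclideanSpace ℝ (Fin n)) M]
  [RiemannianBundle (fun x : M ↦ TangentSpace 𝓘(ℝ, EuclideanSpace ℝ (Fin n)) x)]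
  [MeasurableSpace M]

/-- The explicit density of a tilt agrees with the Radon–Nikodym derivative only almost everywhere,
so the form must be insensitive to the representative. -/
lemma IsFormApprox.congr {μ : Measure M} {f f' : M → ℝ} {g : ℕ → M → ℝ} (h : f =ᵐ[μ] f')
    (hg : IsFormApprox n μ f g) : IsFormApprox n μ f' g where
  smooth := hg.smooth
  compact_support := hg.compact_support
  tendsto_L2 := by
    have : ∀ k, eLpNorm (g k - f') 2 μ = eLpNorm (g k - f) 2 μ := fun k ↦
      eLpNorm_congr_ae (h.mono fun x hx ↦ by simp [hx])
    simpa only [this] using hg.tendsto_L2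
  cauchy := hg.cauchy

lemma mem_dirichletDomain_congr {μ : Measure M} {f f' : M → ℝ} (h : f =ᵐ[μ] f')
    (hf : f ∈ dirichletDomain n μ) : f' ∈ dirichletDomain n μ := by
  obtain ⟨h1, g, hg⟩ := hf
  exact ⟨h1.ae_eq h, g, hg.congr h⟩

lemma dirichletForm_le_of_ae_eq {μ : Measure M} {f f' : M → ℝ} (h : f =ᵐ[μ] f') :
    dirichletForm n μ f' ≤ dirichletForm n μ f :=
  le_iInf₂ fun g hg ↦ iInf₂_le g (hg.congr h)

variable [IsManifold 𝓘(ℝ, EuclideanSpace ℝ (Fin n)) ∞ M]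
  [IsContinuousRiemannianBundle (EuclideanSpace ℝ (Fin n))
    (fun x : M ↦ TangentSpace 𝓘(ℝ, EuclideanSpace ℝ (Fin n)) x)]
  [ProperSpace M] [IsRiemannianManifold 𝓘(ℝ, EuclideanSpace ℝ (Fin n)) M] [BorelSpace M]

/-- The Fisher information of the exponential tilt `e^{tG} μ / ∫ e^{tG} dμ`. -/
lemma fisherInformation_tilted_le [Nonempty M] {μ : Measure M} [IsProbabilityMeasure μ] {G : M → ℝ}
    (hG : ContMDiff 𝓘(ℝ, EuclideanSpace ℝ (Fin n)) 𝓘(ℝ, ℝ) ∞ G) (hGc : HasCompactSupport G)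
    {L : ℝ} (hL : ∀ y, gradNorm n G y ≤ L) (t : ℝ) :
    fisherInformation n (μ.tilted fun x ↦ t * G x) μ ≤ ENNReal.ofReal (t ^ 2 * L ^ 2 / 4) := by
  obtain ⟨D, hD⟩ : ∃ D, ∀ y, |G y| ≤ D := hGc.exists_bound_of_continuous hG.continuous
  have exp_int : Integrable (fun x ↦ Real.exp (t * G x)) μ :=
    ProbabilityTheory.integrable_exp_mul_of_mem_Icc hG.continuous.aemeasurable
      (ae_of_all _ fun x ↦ abs_le.1 (hD x))
  set Z := ∫ x, Real.exp (t * G x) ∂μ with hZ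
  have Z_pos : 0 < Z := integral_exp_pos exp_int
  set a := (√Z)⁻¹ with ha
  have a_sq : a ^ 2 = Z⁻¹ := by rw [ha, inv_pow, Real.sq_sqrt Z_pos.le]
  -- The square root of the density is a e^{tG/2}. Subtracting its value a at G = 0 leaves a
  -- compactly supported function, and the constant is added back by
  -- `add_const_mem_dirichletDomain`.
  let φ : ℝ → ℝ := fun s ↦ a * Real.exp (t * s / 2) - a
  have φ_deriv : ∀ s, HasDerivAt φ (a * (Real.exp (t * s / 2) * (t / 2))) s := fun s ↦ by
    have h1 := (((hasDerivAt_id s).const_mul t).div_const 2).exp.const_mul a |>.sub_const a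
    rw [mul_one] at h1
    exact h1
  have φ_smooth : ContDiff ℝ ∞ φ := by fun_prop
  have φ_zero : φ 0 = 0 := by simp [φ]
  have u_smooth : ContMDiff 𝓘(ℝ, EuclideanSpace ℝ (Fin n)) 𝓘(ℝ, ℝ) ∞ (fun y ↦ φ (G y)) :=
    φ_smooth.contMDiff.comp hG
  have u_compact : HasCompactSupport (fun y ↦ φ (G y)) := hGc.comp_left φ_zero
  obtain ⟨mem, le⟩ := add_const_mem_dirichletDomain (μ := μ) (n := n) u_smooth u_compact a
    -- The bound is t² L² / 4 times the density of the tilt, hence integrates to t² L² / 4.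
    (w := fun y ↦ t ^ 2 * L ^ 2 / 4 * (Z⁻¹ * Real.exp (t * G y))) fun y ↦ by
      have h1 : gradNorm n (fun y ↦ φ (G y)) y ≤
          |a * (Real.exp (t * G y / 2) * (t / 2))| * L := by
        rw [gradNorm, differential_comp ((hG y).mdifferentiableAt (by simp)) (φ_deriv _)]
        exact (norm_covector_smul_le _ _).trans (mul_le_mul_of_nonneg_left (hL y) (abs_nonneg _))
      refine (pow_le_pow_left₀ (norm_covector_nonneg _) h1 2).trans_eq ?_
      have h2 : Real.exp (t * G y) = Real.exp (t * G y / 2) ^ 2 := by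
        rw [← Real.exp_nat_mul]
        congr 1
        push_cast
        ring
      rw [mul_pow, sq_abs, ← a_sq, h2]
      ring
  have ae_eq : (fun y ↦ φ (G y) + a) =ᵐ[μ]
      fun x ↦ √((μ.tilted fun x ↦ t * G x).rnDeriv μ x).toReal := by
    filter_upwards [rnDeriv_tilted_left_self (μ := μ) (f := fun x ↦ t * G x)
      (hG.continuous.aemeasurable.const_mul t)] with x hx
    rw [hx, ENNReal.toReal_ofReal (by positivity), Real.sqrt_div (Real.exp_pos _).le,
      ← Real.exp_half, ← hZ, div_eq_inv_mul]
    simp [φ, ha]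
  rw [fisherInformation,
    if_pos ⟨tilted_absolutelyContinuous _ _, mem_dirichletDomain_congr ae_eq mem⟩]
  refine ((dirichletForm_le_of_ae_eq ae_eq).trans le).trans_eq ?_
  rw [← ofReal_integral_eq_lintegral_ofReal ((exp_int.const_mul _).const_mul _)
    (ae_of_all _ fun y ↦ by positivity), integral_const_mul, integral_const_mul, ← hZ,
    inv_mul_cancel₀ Z_pos.ne', mul_one]

/-- The Herbst argument for tilts by a smooth approximation G of F, followed by letting the accuracy
tend to 0. -/
lemma cgf_le_of_hasCompactSupport [SecondCountableTopology M] [Nonempty M] {μ : Measure M}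
    [IsProbabilityMeasure μ] {C : ℝ} (hC : 0 ≤ C) (hI : SatisfiesWOneI n μ C) {F : M → ℝ}
    (hF : LipschitzWith 1 F) (hFc : HasCompactSupport F) {t : ℝ} (ht : 0 ≤ t) :
    ProbabilityTheory.cgf F μ t ≤ (∫ x, F x ∂μ) * t + C * t ^ 2 / 2 := by
  obtain ⟨D, hD⟩ : ∃ D, ∀ y, |F y| ≤ D := hFc.exists_bound_of_continuous hF.continuous
  have F_meas : ∀ ν : Measure M, AEStronglyMeasurable F ν :=
    fun ν ↦ hF.continuous.aestronglyMeasurable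
  have F_int : ∀ ν : Measure M, IsProbabilityMeasure ν → Integrable F ν := fun ν _ ↦
    Integrable.of_bound (F_meas ν) D (ae_of_all _ hD)
  have key : ∀ ε : ℝ, 0 < ε → ProbabilityTheory.cgf F μ t ≤
      (∫ x, F x ∂μ + 2 * ε) * t + C * (1 + ε) * t ^ 2 / 2 := fun ε hε ↦ by
    obtain ⟨G, G_smooth, G_compact, hGF, hG⟩ :=
      exists_contMDiff_hasCompactSupport_gradNorm_le (n := n) hF hFc hε
    obtain ⟨D', hD'⟩ : ∃ D, ∀ y, |G y| ≤ D :=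
      G_compact.exists_bound_of_continuous G_smooth.continuous
    have exp_int : ∀ s, Integrable (fun x ↦ Real.exp (s * G x)) μ := fun s ↦
      ProbabilityTheory.integrable_exp_mul_of_mem_Icc G_smooth.continuous.aemeasurable
        (ae_of_all _ fun x ↦ abs_le.1 (hD' x))
    have G_cgf : ProbabilityTheory.cgf G μ t ≤
        (∫ x, F x ∂μ + ε) * t + C * (1 + ε) * t ^ 2 / 2 := by
      refine cgf_le_of_integral_tilted_le G_smooth.continuous.aemeasurable hD'
        (fun s hs ↦ ?_) ht
      have prob : IsProbabilityMeasure (μ.tilted fun x ↦ s * G x) :=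
        isProbabilityMeasure_tilted (exp_int s)
      have W_le : wassersteinOne (μ.tilted fun x ↦ s * G x) μ ≤
          ENNReal.ofReal (C * (1 + ε) * s) := by
        have h1 := (hI _ prob).trans (mul_le_mul_right
          (fisherInformation_tilted_le G_smooth G_compact hG s) _)
        rw [← ENNReal.ofReal_mul (by positivity)] at h1
        have h2 : 4 * C ^ 2 * (s ^ 2 * (1 + ε) ^ 2 / 4) = (C * (1 + ε) * s) ^ 2 := by ring
        rw [h2, ENNReal.ofReal_pow (by positivity)] at h1
        exact (ENNReal.pow_le_pow_left_iff two_ne_zero).1 h1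
      -- G is needed only for the tilt. The means are compared through F, which is 1-Lipschitz by
      -- hypothesis, and then G ≤ F + ε.
      have h3 := integral_sub_le_of_wassersteinOne_le hF (F_int _ prob) (F_int _ ‹_›)
        (by positivity) W_le
      have h4 : ∫ x, G x ∂μ.tilted (fun x ↦ s * G x) ≤
          ∫ x, (F x + ε) ∂μ.tilted (fun x ↦ s * G x) :=
        integral_mono (Integrable.of_bound G_smooth.continuous.aestronglyMeasurable D'
          (ae_of_all _ hD')) ((F_int _ prob).add (integrable_const _))
          fun x ↦ by linarith [(abs_le.1 (hGF x)).2]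
      rw [integral_add (F_int _ prob) (integrable_const _)] at h4
      simp only [integral_const, probReal_univ, one_smul] at h4
      linarith
    have F_cgf : ProbabilityTheory.cgf F μ t ≤ ProbabilityTheory.cgf G μ t + ε * t := by
      have h1 : ProbabilityTheory.mgf F μ t ≤
          Real.exp (ε * t) * ProbabilityTheory.mgf G μ t := by
        rw [ProbabilityTheory.mgf, ProbabilityTheory.mgf, ← integral_const_mul]
        refine integral_mono (ProbabilityTheory.integrable_exp_mul_of_mem_Icc
          hF.continuous.aemeasurable (ae_of_all _ fun x ↦ abs_le.1 (hD x)))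
          ((exp_int t).const_mul _) fun x ↦ ?_
        beta_reduce
        rw [← Real.exp_add]
        refine Real.exp_le_exp.2 ?_
        nlinarith [(abs_le.1 (hGF x)).1]
      have h2 := Real.log_le_log (ProbabilityTheory.mgf_pos
        (ProbabilityTheory.integrable_exp_mul_of_mem_Icc
          hF.continuous.aemeasurable (ae_of_all _ fun x ↦ abs_le.1 (hD x)))) h1
      rw [Real.log_mul (Real.exp_pos _).ne' (ProbabilityTheory.mgf_pos (exp_int t)).ne',
        Real.log_exp] at h2
      rw [ProbabilityTheory.cgf, ProbabilityTheory.cgf]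
      linarith
    linarith
  have lim : Tendsto (fun ε : ℝ ↦ (∫ x, F x ∂μ + 2 * ε) * t + C * (1 + ε) * t ^ 2 / 2)
      (𝓝[>] 0) (𝓝 ((∫ x, F x ∂μ + 2 * 0) * t + C * (1 + 0) * t ^ 2 / 2)) :=
    ((Continuous.tendsto (by fun_prop) 0).mono_left nhdsWithin_le_nhds)
  rw [mul_zero, add_zero, add_zero, mul_one] at lim
  exact ge_of_tendsto lim (eventually_nhdsWithin_of_forall fun ε hε ↦ key ε hε)

/-- The transportation-information inequality implies Gaussian bounds for the exponential moments
of bounded `1`-Lipschitz functions. -/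
theorem integral_exp_le_of_satisfiesWOneI [SecondCountableTopology M] [Nonempty M] {μ : Measure M}
    [IsProbabilityMeasure μ] {C : ℝ} (hC : 0 ≤ C) (hI : SatisfiesWOneI n μ C) {F : M → ℝ}
    (hF : LipschitzWith 1 F) {D : ℝ} (hD : ∀ x, |F x| ≤ D) {t : ℝ} (ht : 0 ≤ t) :
    ∫ x, Real.exp (t * F x) ∂μ ≤ Real.exp (t * ∫ x, F x ∂μ + C * t ^ 2 / 2) := by
  obtain ⟨x₀⟩ := ‹Nonempty M›
  -- Shifted to be nonnegative, F can be capped by growing tents, which gives compact support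
  -- without losing the Lipschitz constant 1. The shift by D contributes the same factor e^{tD} to
  -- both sides and cancels.
  let Φ : ℕ → M → ℝ := fun k x ↦ min (F x + D) (max 0 ((k : ℝ) - dist x x₀))
  have Φ_lip : ∀ k, LipschitzWith 1 (Φ k) := fun k ↦ lipschitzWith_one_min
    (LipschitzWith.of_le_add fun x y ↦ by
      have := hF.le_add_mul x y
      rw [NNReal.coe_one, one_mul] at this
      linarith) (lipschitzWith_one_max_zero (lipschitzWith_one_const_sub_dist _ _))
  have F_nonneg : ∀ x, 0 ≤ F x + D := fun x ↦ by linarith [(abs_le.1 (hD x)).1]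
  have F_le : ∀ x, F x + D ≤ 2 * D := fun x ↦ by linarith [(abs_le.1 (hD x)).2]
  have Φ_nonneg : ∀ k x, 0 ≤ Φ k x := fun k x ↦ le_min (F_nonneg x) (le_max_left _ _)
  have Φ_le : ∀ k x, Φ k x ≤ 2 * D := fun k x ↦ (min_le_left _ _).trans (F_le x)
  have Φ_compact : ∀ k, HasCompactSupport (Φ k) := fun k ↦
    HasCompactSupport.intro (isCompact_closedBall x₀ (k : ℝ)) fun x hx ↦ by
      rw [Metric.mem_closedBall, not_le] at hx
      simp only [Φ]
      rw [max_eq_left (by linarith), min_eq_right (F_nonneg x)]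
  have Φ_lim : ∀ x, ∀ᶠ k in atTop, Φ k x = F x + D := fun x ↦ by
    obtain ⟨N, hN⟩ := exists_nat_ge (2 * D + dist x x₀)
    filter_upwards [eventually_ge_atTop N] with k hk
    have hk' : (N : ℝ) ≤ k := by exact_mod_cast hk
    exact min_eq_left (le_max_of_le_right (by linarith [F_le x]))
  have F_cont := hF.continuous
  have int_lim : Tendsto (fun k ↦ ∫ x, Φ k x ∂μ) atTop (𝓝 (∫ x, (F x + D) ∂μ)) :=
    tendsto_integral_of_dominated_convergence (fun _ ↦ 2 * D)
      (fun k ↦ (Φ_lip k).continuous.aestronglyMeasurable) (integrable_const _)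
      (fun k ↦ ae_of_all _ fun x ↦ by
        rw [Real.norm_of_nonneg (Φ_nonneg k x)]
        exact Φ_le k x)
      (ae_of_all _ fun x ↦ tendsto_const_nhds.congr' ((Φ_lim x).mono fun k hk ↦ hk.symm))
  have exp_lim : Tendsto (fun k ↦ ∫ x, Real.exp (t * Φ k x) ∂μ) atTop
      (𝓝 (∫ x, Real.exp (t * (F x + D)) ∂μ)) :=
    tendsto_integral_of_dominated_convergence (fun _ ↦ Real.exp (t * (2 * D)))
      (fun k ↦ (Real.continuous_exp.comp
        (continuous_const.mul (Φ_lip k).continuous)).aestronglyMeasurable) (integrable_const _)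
      (fun k ↦ ae_of_all _ fun x ↦ by
        rw [Real.norm_of_nonneg (Real.exp_pos _).le]
        exact Real.exp_le_exp.2 (mul_le_mul_of_nonneg_left (Φ_le k x) ht))
      (ae_of_all _ fun x ↦ tendsto_const_nhds.congr' ((Φ_lim x).mono fun k hk ↦ by
        beta_reduce
        rw [hk]))
  have Φ_exp : ∀ k, ∫ x, Real.exp (t * Φ k x) ∂μ ≤
      Real.exp ((∫ x, Φ k x ∂μ) * t + C * t ^ 2 / 2) := fun k ↦ by
    have h1 := Real.exp_le_exp.2 (cgf_le_of_hasCompactSupport hC hI (Φ_lip k) (Φ_compact k) ht)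
    rwa [ProbabilityTheory.exp_cgf (ProbabilityTheory.integrable_exp_mul_of_mem_Icc
      (Φ_lip k).continuous.aemeasurable
      (ae_of_all _ fun x ↦ (⟨Φ_nonneg k x, Φ_le k x⟩ : Φ k x ∈ Set.Icc 0 (2 * D))))] at h1
  have h1 := le_of_tendsto_of_tendsto' exp_lim
    ((Real.continuous_exp.tendsto _).comp ((int_lim.mul_const t).add_const (C * t ^ 2 / 2))) Φ_exp
  have h2 : ∀ x, Real.exp (t * (F x + D)) = Real.exp (t * D) * Real.exp (t * F x) := fun x ↦ by
    rw [← Real.exp_add]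
    ring_nf
  simp_rw [h2] at h1
  rw [integral_const_mul, integral_add (Integrable.of_bound F_cont.aestronglyMeasurable D
    (ae_of_all _ hD)) (integrable_const _), integral_const, probReal_univ, one_smul] at h1
  have h3 : (∫ x, F x ∂μ + D) * t + C * t ^ 2 / 2 = t * D + (t * ∫ x, F x ∂μ + C * t ^ 2 / 2) := by
    ring
  rw [h3, Real.exp_add] at h1
  exact le_of_mul_le_mul_left h1 (Real.exp_pos _)

end Fisher

end Herbst

/-! ### From Gaussian exponential moments to W₁H -/

section BobkovGoetze

open InformationTheory

/-- The easy half of the Donsker–Varadhan variational formula for the relative entropy. -/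
lemma integral_le_toReal_klDiv_add_log_integral_exp {X : Type*} [MeasurableSpace X]
    {ν μ : Measure X} [IsProbabilityMeasure ν] [IsProbabilityMeasure μ] (h : klDiv ν μ ≠ ⊤)
    {F : X → ℝ} (hν : Integrable F ν) (hμ : Integrable (fun x ↦ Real.exp (F x)) μ) :
    ∫ x, F x ∂ν ≤ (klDiv ν μ).toReal + Real.log (∫ x, Real.exp (F x) ∂μ) := by
  obtain ⟨hac, hint⟩ := klDiv_ne_top_iff.1 h
  have prob : IsProbabilityMeasure (μ.tilted F) := isProbabilityMeasure_tilted hμ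
  -- This is the nonnegativity of the entropy of ν relative to the tilt of μ by F, expanded in terms
  -- of H(ν|μ).
  have h1 := integral_llr_add_sub_measure_univ_nonneg
    (hac.trans (absolutelyContinuous_tilted hμ)) (integrable_llr_tilted_right hac hν hint hμ)
  rw [integral_llr_tilted_right hac hν hμ hint, probReal_univ, probReal_univ] at h1
  rw [toReal_klDiv_of_measure_eq hac (by simp)]
  linarith

/-- Monotone convergence. It extracts finite first moments, needed for duality, from estimates
available only for bounded functions. -/
lemma integrable_dist_of_integral_min_le {X : Type*} [PseudoMetricSpace X] [MeasurableSpace X]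
    [OpensMeasurableSpace X] {ν : Measure X} [IsProbabilityMeasure ν] {x₀ : X} {A : ℝ}
    (h : ∀ k : ℕ, ∫ x, min (dist x x₀) k ∂ν ≤ A) : Integrable (fun x ↦ dist x x₀) ν := by
  have dist_cont : Continuous fun x ↦ dist x x₀ := continuous_id.dist continuous_const
  have min_cont : ∀ k : ℕ, Continuous fun x ↦ min (dist x x₀) k :=
    fun k ↦ dist_cont.min continuous_const
  rw [← lintegral_ofReal_ne_top_iff_integrable dist_cont.measurable.aestronglyMeasurable
    (ae_of_all _ fun x ↦ dist_nonneg)]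
  have lim : Tendsto (fun k : ℕ ↦ ∫⁻ x, ENNReal.ofReal (min (dist x x₀) k) ∂ν) atTop
      (𝓝 (∫⁻ x, ENNReal.ofReal (dist x x₀) ∂ν)) := by
    refine lintegral_tendsto_of_tendsto_of_monotone
      (fun k ↦ (min_cont k).measurable.ennreal_ofReal.aemeasurable)
      (ae_of_all _ fun x k l hkl ↦ ?_) (ae_of_all _ fun x ↦ ?_)
    · exact ENNReal.ofReal_le_ofReal (min_le_min_left _ (by exact_mod_cast hkl))
    · obtain ⟨N, hN⟩ := exists_nat_ge (dist x x₀)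
      refine tendsto_const_nhds.congr' ?_
      filter_upwards [eventually_ge_atTop N] with k hk
      rw [min_eq_left (hN.trans (by exact_mod_cast hk))]
  refine ne_top_of_le_ne_top ENNReal.ofReal_ne_top (b := ENNReal.ofReal A)
    (le_of_tendsto' lim fun k ↦ ?_)
  have nonneg : ∀ x, 0 ≤ min (dist x x₀) k := fun x ↦ le_min dist_nonneg k.cast_nonneg
  rw [← ofReal_integral_eq_lintegral_ofReal (Integrable.of_bound
    (min_cont k).measurable.aestronglyMeasurable (k : ℝ) (ae_of_all _ fun x ↦ by
      rw [Real.norm_of_nonneg (nonneg x)]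
      exact min_le_right _ _)) (ae_of_all _ nonneg)]
  exact ENNReal.ofReal_le_ofReal (h k)

/-- Gaussian bounds for the exponential moments of bounded `1`-Lipschitz functions imply the
transportation-entropy inequality. -/
theorem satisfiesWOneH_of_integral_exp_le {X : Type*} [MetricSpace X] [MeasurableSpace X]
    [BorelSpace X] [ProperSpace X] [Nonempty X] {μ : Measure X} [IsProbabilityMeasure μ] {C : ℝ}
    (hC : 0 < C)
    (hexp : ∀ F : X → ℝ, LipschitzWith 1 F → ∀ D, (∀ x, |F x| ≤ D) → ∀ t, 0 ≤ t →
      ∫ x, Real.exp (t * F x) ∂μ ≤ Real.exp (t * ∫ x, F x ∂μ + C * t ^ 2 / 2)) :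
    SatisfiesWOneH μ C := by
  obtain ⟨x₀⟩ := ‹Nonempty X›
  intro ν _
  rcases eq_or_ne (klDiv ν μ) ⊤ with hH | hH
  · rw [hH, ENNReal.mul_top (by simpa using hC)]
    exact le_top
  set H := (klDiv ν μ).toReal
  have H_nonneg : 0 ≤ H := ENNReal.toReal_nonneg
  have bdd_int : ∀ (ρ : Measure X) [IsProbabilityMeasure ρ] (F : X → ℝ), LipschitzWith 1 F →
      ∀ D, (∀ x, |F x| ≤ D) → Integrable F ρ := fun ρ _ F hF D hD ↦
    Integrable.of_bound hF.continuous.aestronglyMeasurable D (ae_of_all _ hD)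
  have key : ∀ F : X → ℝ, LipschitzWith 1 F → ∀ D, (∀ x, |F x| ≤ D) → ∀ t, 0 ≤ t →
      t * (∫ x, F x ∂ν - ∫ x, F x ∂μ) ≤ H + C * t ^ 2 / 2 := fun F hF D hD t ht ↦ by
    have exp_int : Integrable (fun x ↦ Real.exp (t * F x)) μ :=
      ProbabilityTheory.integrable_exp_mul_of_mem_Icc hF.continuous.aemeasurable
        (ae_of_all _ fun x ↦ abs_le.1 (hD x))
    have h1 := integral_le_toReal_klDiv_add_log_integral_exp hH
      ((bdd_int ν F hF D hD).const_mul t) exp_int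
    have h2 := Real.log_le_log (integral_exp_pos exp_int) (hexp F hF D hD t ht)
    rw [Real.log_exp] at h2
    rw [integral_const_mul] at h1
    linarith
  let d : ℕ → X → ℝ := fun k x ↦ min (dist x x₀) k
  have d_lip : ∀ k, LipschitzWith 1 (d k) := fun k ↦ (LipschitzWith.dist_left x₀).min_const _
  have d_nonneg : ∀ k x, 0 ≤ d k x := fun k x ↦ le_min dist_nonneg k.cast_nonneg
  have d_bdd : ∀ k x, |d k x| ≤ k := fun k x ↦ by
    rw [abs_of_nonneg (d_nonneg k x)]
    exact min_le_right _ _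
  have exp_neg_int : Integrable (fun x ↦ Real.exp (-dist x x₀)) μ :=
    Integrable.of_bound (Real.continuous_exp.comp
      (continuous_id.dist continuous_const).neg).aestronglyMeasurable 1 (ae_of_all _ fun x ↦ by
        rw [Real.norm_of_nonneg (Real.exp_pos _).le, Real.exp_le_one_iff]
        exact neg_nonpos.2 dist_nonneg)
  -- The exponential bound for the negative truncated distance at t = 1 controls its mean from
  -- above, since ∫ e^{-d} dμ > 0 is a lower bound independent of the truncation.
  have hμ : Integrable (fun x ↦ dist x x₀) μ := by
    refine integrable_dist_of_integral_min_le
      (A := C / 2 - Real.log (∫ x, Real.exp (-dist x x₀) ∂μ)) fun k ↦ ?_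
    have neg_bdd : ∀ x, |-d k x| ≤ k := fun x ↦ (abs_neg _).trans_le (d_bdd k x)
    have h1 := hexp (fun x ↦ -d k x) (d_lip k).neg k neg_bdd 1 zero_le_one
    have h2 : ∫ x, Real.exp (-dist x x₀) ∂μ ≤ ∫ x, Real.exp (1 * -d k x) ∂μ := by
      refine integral_mono exp_neg_int (ProbabilityTheory.integrable_exp_mul_of_mem_Icc
        (X := fun x ↦ -d k x) (d_lip k).neg.continuous.aemeasurable
        (ae_of_all _ fun x ↦ abs_le.1 (neg_bdd x))) fun x ↦ Real.exp_le_exp.2 ?_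
      rw [one_mul]
      exact neg_le_neg (min_le_left _ _)
    have h3 := Real.log_le_log (integral_exp_pos exp_neg_int) (h2.trans h1)
    rw [Real.log_exp, integral_neg] at h3
    change ∫ x, d k x ∂μ ≤ _
    linarith
  have hν : Integrable (fun x ↦ dist x x₀) ν := by
    refine integrable_dist_of_integral_min_le (A := H + C / 2 + ∫ x, dist x x₀ ∂μ) fun k ↦ ?_
    have h1 := key (d k) (d_lip k) k (d_bdd k) 1 zero_le_one
    have h2 : ∫ x, d k x ∂μ ≤ ∫ x, dist x x₀ ∂μ :=
      integral_mono (bdd_int μ _ (d_lip k) k (d_bdd k)) hμ fun x ↦ min_le_left _ _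
    change ∫ x, d k x ∂ν ≤ _
    linarith
  have sqrt_bound : ∀ F : X → ℝ, LipschitzWith 1 F → ∀ D, (∀ x, |F x| ≤ D) →
      ∫ x, F x ∂ν - ∫ x, F x ∂μ ≤ √(2 * C * H) := fun F hF D hD ↦ by
    rcases le_total (∫ x, F x ∂ν - ∫ x, F x ∂μ) 0 with hs | hs
    · exact hs.trans (Real.sqrt_nonneg _)
    · refine Real.le_sqrt_of_sq_le ?_
      -- With s the difference of means, t = s / C maximizes t s - C t² / 2, with value s² / (2 C).
      have h1 := key F hF D hD _ (div_nonneg hs hC.le)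
      set s := ∫ x, F x ∂ν - ∫ x, F x ∂μ
      have h2 := mul_le_mul_of_nonneg_left h1 (by positivity : 0 ≤ 2 * C)
      have h3 : 2 * C * (s / C * s) = 2 * s ^ 2 := by field_simp
      have h4 : 2 * C * (H + C * (s / C) ^ 2 / 2) = 2 * C * H + s ^ 2 := by field_simp
      linarith
  have dual : wassersteinOne ν μ ≤ ENNReal.ofReal (√(2 * C * H)) := by
    refine wassersteinOne_le_of_forall_lipschitzWith hν hμ fun f hf ↦ ?_
    -- Duality tests all 1-Lipschitz functions, the bound is known for bounded ones; truncation and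
    -- the first moments bridge the gap.
    let f' : ℕ → X → ℝ := fun k x ↦ max (min (f x) k) (-k)
    have f'_lip : ∀ k, LipschitzWith 1 (f' k) := fun k ↦ (hf.min_const _).max_const _
    have f'_bdd : ∀ k x, |f' k x| ≤ k := fun k x ↦ by
      have : (0 : ℝ) ≤ k := k.cast_nonneg
      exact abs_le.2 ⟨le_max_right _ _, max_le (min_le_right _ _) (by linarith)⟩
    have f'_le : ∀ k x, |f' k x| ≤ |f x| := fun k x ↦ by
      have : (0 : ℝ) ≤ k := k.cast_nonneg
      refine abs_le.2 ⟨?_, max_le ((min_le_left _ _).trans (le_abs_self _)) ?_⟩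
      · exact le_max_of_le_left (le_min (neg_abs_le _) (by linarith [abs_nonneg (f x)]))
      · linarith [abs_nonneg (f x)]
    have lim : ∀ ρ : Measure X, Integrable f ρ →
        Tendsto (fun k ↦ ∫ x, f' k x ∂ρ) atTop (𝓝 (∫ x, f x ∂ρ)) := fun ρ hρ ↦
      tendsto_integral_of_dominated_convergence (fun x ↦ |f x|)
        (fun k ↦ (f'_lip k).continuous.aestronglyMeasurable) hρ.abs
        (fun k ↦ ae_of_all _ (f'_le k)) (ae_of_all _ fun x ↦ by
          obtain ⟨N, hN⟩ := exists_nat_ge |f x|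
          refine tendsto_const_nhds.congr' ?_
          filter_upwards [eventually_ge_atTop N] with k hk
          have hk' : |f x| ≤ k := hN.trans (by exact_mod_cast hk)
          simp only [f']
          rw [min_eq_left (abs_le.1 hk').2, max_eq_left (abs_le.1 hk').1])
    exact le_of_tendsto' ((lim ν (integrable_of_lipschitzWith_one hν hf)).sub
      (lim μ (integrable_of_lipschitzWith_one hμ hf)))
      fun k ↦ sqrt_bound _ (f'_lip k) k (f'_bdd k)
  calc wassersteinOne ν μ ^ 2 ≤ ENNReal.ofReal (√(2 * C * H)) ^ 2 := by gcongr
    _ = ENNReal.ofReal (2 * C) * klDiv ν μ := by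
      rw [← ENNReal.ofReal_pow (Real.sqrt_nonneg _), Real.sq_sqrt (by positivity),
        ENNReal.ofReal_mul (by positivity), ENNReal.ofReal_toReal hH]

end BobkovGoetze

lemma isProbabilityMeasure_gibbsMeasure {n : ℕ} {M : Type*} [TopologicalSpace M]
    [MeasurableSpace M] [ChartedSpace (EuclideanSpace ℝ (Fin n)) M]
    [RiemannianBundle (fun x : M ↦ TangentSpace 𝓘(ℝ, EuclideanSpace ℝ (Fin n)) x)] {V : M → ℝ}
    (h0 : normalization n V ≠ 0) (htop : normalization n V ≠ ⊤) :
    IsProbabilityMeasure (gibbsMeasure n V) where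
  measure_univ := by
    rw [gibbsMeasure, Measure.smul_apply, withDensity_apply _ MeasurableSet.univ,
      Measure.restrict_univ, smul_eq_mul]
    exact ENNReal.inv_mul_cancel h0 htop

lemma gibbsMeasure_eq_zero {n : ℕ} {M : Type*} [TopologicalSpace M]
    [MeasurableSpace M] [ChartedSpace (EuclideanSpace ℝ (Fin n)) M]
    [RiemannianBundle (fun x : M ↦ TangentSpace 𝓘(ℝ, EuclideanSpace ℝ (Fin n)) x)] {V : M → ℝ}
    (h0 : normalization n V = 0) : gibbsMeasure n V = 0 := by
  have : (riemannianVolume n M).withDensity (fun x ↦ ENNReal.ofReal (Real.exp (-V x))) = 0 := by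
    rw [← Measure.measure_univ_eq_zero, withDensity_apply _ MeasurableSet.univ,
      Measure.restrict_univ]
    exact h0
  rw [gibbsMeasure, this, smul_zero]

end

end TransportInformation

theorem theorem2p1 {n : ℕ} {M : Type*} [MetricSpace M] [MeasurableSpace M] [BorelSpace M]
    [ConnectedSpace M] [CompleteSpace M] [SecondCountableTopology M]
    [ChartedSpace (EuclideanSpace ℝ (Fin n)) M]
    [IsManifold 𝓘(ℝ, EuclideanSpace ℝ (Fin n)) ∞ M]
    [RiemannianBundle (fun x : M ↦ TangentSpace 𝓘(ℝ, EuclideanSpace ℝ (Fin n)) x)]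
    [IsContMDiffRiemannianBundle 𝓘(ℝ, EuclideanSpace ℝ (Fin n)) ∞ (EuclideanSpace ℝ (Fin n))
      (fun x : M ↦ TangentSpace 𝓘(ℝ, EuclideanSpace ℝ (Fin n)) x)]
    [IsRiemannianManifold 𝓘(ℝ, EuclideanSpace ℝ (Fin n)) M]
    (V : M → ℝ) (hV : ContMDiff 𝓘(ℝ, EuclideanSpace ℝ (Fin n)) 𝓘(ℝ, ℝ) 1 V)
    (hZ : TransportInformation.normalization n V ≠ ⊤)
    (C : ℝ) (hC : 0 < C)
    (hI : TransportInformation.SatisfiesWOneI n (TransportInformation.gibbsMeasure n V) C) :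
    TransportInformation.SatisfiesWOneH (TransportInformation.gibbsMeasure n V) C := by
  -- For Z = 0 the Gibbs measure would be the zero measure, relative to which every probability
  -- measure has infinite entropy; this disposes of the case without proving Z > 0.
  rcases eq_or_ne (TransportInformation.normalization n V) 0 with h0 | h0
  · intro ν _
    rw [TransportInformation.gibbsMeasure_eq_zero h0, InformationTheory.klDiv_zero_right,
      ENNReal.mul_top (by simpa using hC)]
    exact le_top
  · have : IsContinuousRiemannianBundle (EuclideanSpace ℝ (Fin n))
        (fun x : M ↦ TangentSpace 𝓘(ℝ, EuclideanSpace ℝ (Fin n)) x) := by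
      obtain ⟨g, g_smooth, hg⟩ := ‹IsContMDiffRiemannianBundle 𝓘(ℝ, EuclideanSpace ℝ (Fin n)) ∞
        (EuclideanSpace ℝ (Fin n))
        (fun x : M ↦ TangentSpace 𝓘(ℝ, EuclideanSpace ℝ (Fin n)) x)›.exists_contMDiff
      exact ⟨g, g_smooth.continuous, hg⟩
    have := TransportInformation.isProbabilityMeasure_gibbsMeasure h0 hZ
    have : LocallyCompactSpace M :=
      Manifold.locallyCompact_of_finiteDimensional 𝓘(ℝ, EuclideanSpace ℝ (Fin n))
    have : ProperSpace M := TransportInformation.properSpace_of_isRiemannianManifold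
      𝓘(ℝ, EuclideanSpace ℝ (Fin n)) M
    exact TransportInformation.satisfiesWOneH_of_integral_exp_le hC fun F hF D hD t ht ↦
      TransportInformation.integral_exp_le_of_satisfiesWOneI hC.le hI hF hD ht
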